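/- Notation. $\mathcal A_d=\{0,\dots,d-1\}$. For words $q,q'$ of length $k\ge 1$ over $\mathcal A_d$, $c_b(q)=\frac1k|\{j: q_j=b\}|$ is the relative count of the letter $b$ and $\Delta_H(q,q')=\frac1k|\{j:q_j\ne q'_j\}|$ is the relative Hamming distance. The $d$-ary entropy is $H_d(x)=x\log_d(d-1)-x\log_d x-(1-x)\log_d(1-x)$ (with $0\log_d 0=0$), and the extended $d$-ary entropy is $\bar H(x)=0$ if $x<0$, $\bar H(x)=H_d(x)$ if $0\le x\le 1-1/d$, and $\bar H(x)=1$ if $x>1-1/d$. A density operator is a positive semidefinite operator of trace one; Hilbert spaces are finite-dimensional complex; $\|\cdot\|$ is the trace norm $\|M\|=\operatorname{tr}\sqrt{M^\dagger M}$. For a density operator $\rho_{AE}$, \[ H_{\min}(A|E)_\rho=\sup_{\sigma_E}\max\{\lambda\in\mathbb R : 2^{-\lambda} I_A\otimes\sigma_E-\rho_{AE}\ge 0\},\qquad H^{s}_{\min}(A|E)_\rho=\sup_{\tau:\ \|\rho-\tau\|\le s}H_{\min}(A|E)_\tau , \] where $\sigma_E$ ranges over the density operators on $E$ and $\tau$ over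 the density operators on $AE$. Theorem. Let $\epsilon>0$, $0<\beta<1/2$, $d\ge 2$, $1\le m\le n$, and let $\rho_{ABE}$ be an arbitrary density operator on $\mathcal H_A\otimes\mathcal H_B\otimes\mathcal H_E$, where $\mathcal H_A\cong\mathcal H_B\cong\mathcal H_d^{\otimes(n+m)}$ and $\mathcal H_d$ has dimension $d$. Let $Z=\{|z_a\rangle\}_{a\in\mathcal A_d}$ and $X=\{|x_b\rangle\}_{b\in\mathcal A_d}$ be two orthonormal bases of $\mathcal H_d$, let $\hat\gamma=-\log_2\max_{a,b}|\langle z_a|x_b\rangle|^2$, let $(a^*,b^*)$ be a pair that attains this maximum, and let \[ \gamma=-\log_2\max_{(a,b)\ne(a^*,b^*)}|\langle z_a|x_b\rangle|^2,\qquad \delta=\sqrt{\frac{(m+n+2)\ln(4/\epsilon^2)}{m(m+n)}} \] (for $\epsilon>2$, where the radicand is negative, put $\delta=0$; the probability bound below then exceeds $1$). Consider the following experiment with input $\rho_{TABE}=\frac1T\sum_t|t\rangle\langle t|\otimes\rho_{ABE}$, where $t$ runs over the $T=\binom{n+m}{m}$ subsets of $\{1,\dots,n+m\}$ of size $m$: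 the register $T$ is measured, giving $t$; then the qudits indexed by $t$ of $A$ and of $B$ are measured in the basis $X$, giving words $q_A,q_B\in\mathcal A_d^m$ and a normalized post-measurement state $\rho(t,q_A,q_B)$ of the remaining $n$ qudits of $A$, the remaining $n$ qudits of $B$, and $E$. Let $H_{\min}^{s}(A_Z|E)_{\rho(t,q_A,q_B)}$ be the smooth min-entropy of the state obtained from $\rho(t,q_A,q_B)$ by tracing out $B$ and measuring the remaining $n$ qudits of $A$ in the basis $Z$. Then, except with probability at most $2\epsilon^{1-2\beta}$ over $(t,q_A,q_B)$, \[ H_{\min}^{4\epsilon+2\epsilon^\beta}(A_Z|E)_{\rho(t,q_A,q_B)}+\frac{n\,\bar H(\Delta_H(q_A,q_B)+\delta)}{\log_d 2}\ \ge\ n\,(c_{b^*}(q_A)+\delta)\,\hat\gamma+n\,(1-c_{b^*}(q_A)-\delta)\,\gamma . \] If $\hat\gamma=\gamma$, then, except with probability at most $2\epsilon^{1-2\beta}$, \[ H_{\min}^{4\epsilon+2\epsilon^\beta}(A_Z|E)_{\rho(t,q_A,q_B)}+\frac{n\,\bar H(\Delta_H(q_A,q_B)+\delta)}{\log_d 2}\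 \ge\ n\gamma . \] -/

import Mathlib

open scoped Kronecker ComplexOrder

noncomputable section

namespace QSampling

/-! ### Words over a `d`-letter alphabet -/

/-- Words over the alphabet `{0, …, d-1}` whose positions are indexed by `κ`. -/
abbrev Word (κ : Type*) (d : ℕ) := κ → Fin d

/-- Relative number of occurrences `c_b(q)` of the letter `b` in the word `q`. -/
def relCount {κ : Type*} [Fintype κ] {d : ℕ} (b : Fin d) (q : Word κ d) : ℝ :=
  ((Finset.univ.filter fun k => q k = b).card : ℝ) / (Fintype.card κ : ℝ)

/-- Relative Hamming distance `Δ_H(x, y)` of two words. -/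
def relHammingDist {κ : Type*} [Fintype κ] {d : ℕ} (x y : Word κ d) : ℝ :=
  ((Finset.univ.filter fun k => x k ≠ y k).card : ℝ) / (Fintype.card κ : ℝ)

/-- The `d`-ary entropy function `H_d`. -/
def dEntropy (d : ℕ) (x : ℝ) : ℝ :=
  x * Real.logb d ((d : ℝ) - 1) - x * Real.logb d x - (1 - x) * Real.logb d (1 - x)

/-- The extended `d`-ary entropy function `H̄_d`. -/
def extEntropy (d : ℕ) (x : ℝ) : ℝ :=
  if x < 0 then 0 else if x ≤ 1 - 1 / (d : ℝ) then dEntropy d x else 1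

/-! ### States, trace norm, min-entropy

The Hilbert space with orthonormal basis indexed by a finite type `ι` is `ℂ^ι`; its operators are
the matrices indexed by `ι`, and tensor products correspond to products of index types. -/

/-- Density operators: positive semidefinite with trace one. -/
def IsDensity {ι : Type*} [Fintype ι] (ρ : Matrix ι ι ℂ) : Prop :=
  ρ.PosSemidef ∧ ρ.trace = 1

/-- The trace norm `‖M‖₁ = tr √(Mᴴ M)`, i.e. the sum of the singular values of `M`. -/
def traceNorm {ι : Type*} [Fintype ι] [DecidableEq ι] (M : Matrix ι ι ℂ) : ℝ :=
  ∑ i, Real.sqrt ((Matrix.isHermitian_conjTranspose_mul_self M).eigenvalues i)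

/-- Conditional min-entropy `H_min(A|E)_ρ`: the supremum, over density operators `σ` of `E` and real
`l` with `2^(-l) I_A ⊗ σ - ρ ≥ 0`, of `l`. -/
def minEntropy {α ε : Type*} [Fintype α] [DecidableEq α] [Fintype ε]
    (ρ : Matrix (α × ε) (α × ε) ℂ) : EReal :=
  ⨆ (σ : Matrix ε ε ℂ) (l : ℝ) (_ : IsDensity σ ∧
    ((((2 : ℝ) ^ (-l) : ℝ) : ℂ) • ((1 : Matrix α α ℂ) ⊗ₖ σ) - ρ).PosSemidef), (l : EReal)

/-- Smooth conditional min-entropy `H_min^s(A|E)_ρ`: the supremum of `H_min(A|E)_τ` over the density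
operators `τ` with `‖ρ - τ‖₁ ≤ s`. -/
def smoothMinEntropy {α ε : Type*} [Fintype α] [DecidableEq α] [Fintype ε] [DecidableEq ε]
    (s : ℝ) (ρ : Matrix (α × ε) (α × ε) ℂ) : EReal :=
  ⨆ (τ : Matrix (α × ε) (α × ε) ℂ) (_ : IsDensity τ ∧ traceNorm (ρ - τ) ≤ s), minEntropy τ

/-! ### Bases, overlaps, measurements -/

/-- Orthonormal bases of the `d`-dimensional Hilbert space. -/
abbrev QBasis (d : ℕ) := OrthonormalBasis (Fin d) ℂ (EuclideanSpace ℂ (Fin d))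

/-- `|⟨z_a|x_b⟩|²`. -/
def overlap {d : ℕ} (Z X : QBasis d) (a b : Fin d) : ℝ := ‖inner ℂ (Z a) (X b)‖ ^ 2

/-- `max_{a,b} |⟨z_a|x_b⟩|²`. -/
def maxOverlap {d : ℕ} (Z X : QBasis d) : ℝ := ⨆ p : Fin d × Fin d, overlap Z X p.1 p.2

/-- The maximum of `|⟨z_a|x_b⟩|²` over the pairs `(a, b)` other than `(a', b')`. -/
def maxOverlapExcept {d : ℕ} (Z X : QBasis d) (a' b' : Fin d) : ℝ :=
  ⨆ p : {p : Fin d × Fin d // p ≠ (a', b')}, overlap Z X p.1.1 p.1.2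

/-- The coordinate at `w` of the product vector `|v_i⟩ = ⨂ₖ |v_{i_k}⟩`. -/
def prodKet {κ : Type*} [Fintype κ] {d : ℕ} (V : QBasis d) (i w : Word κ d) : ℂ :=
  ∏ k, V (i k) (w k)

/-- Partial trace over the middle system `B` of a tripartite operator on `A ⊗ B ⊗ E`. -/
def traceOutB {α β ε : Type*} [Fintype β] (ρ : Matrix (α × β × ε) (α × β × ε) ℂ) :
    Matrix (α × ε) (α × ε) ℂ :=
  fun i j => ∑ b, ρ (i.1, b, i.2) (j.1, b, j.2)

/-- The classical-quantum state `∑_z |z⟩⟨z| ⊗ ⟨v_z| ρ |v_z⟩` obtained from `ρ_AE` by measuring every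
qudit of `A` in the basis `V`. -/
def measureA {κ ε : Type*} [Fintype κ] [DecidableEq κ] {d : ℕ} (V : QBasis d)
    (ρ : Matrix (Word κ d × ε) (Word κ d × ε) ℂ) : Matrix (Word κ d × ε) (Word κ d × ε) ℂ :=
  fun i j =>
    if i.1 = j.1 then
      ∑ w, ∑ w', star (prodKet V i.1 w) * ρ (w, i.2) (w', j.2) * prodKet V i.1 w'
    else 0

/-! ### The sampling experiment -/

/-- The subsets of size `m` of the `n + m` positions. -/
abbrev SampleSet (n m : ℕ) := {t : Finset (Fin (n + m)) // t.card = m}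

/-- Index type of the sampled positions. -/
abbrev Sampled {n m : ℕ} (t : SampleSet n m) := {i : Fin (n + m) // i ∈ t.1}

/-- Index type of the remaining positions. -/
abbrev Rest {n m : ℕ} (t : SampleSet n m) := {i : Fin (n + m) // i ∉ t.1}

/-- Index type of `H_A ⊗ H_B ⊗ H_E` with `H_A = H_B` a system of qudits at the positions `κ`. -/
abbrev ABE (κ : Type*) (d : ℕ) (E : Type*) := Word κ d × Word κ d × E

/-- `ρ_TABE = (1/T) ∑_t |t⟩⟨t| ⊗ ρ_ABE`, where `t` runs over the `T = C(n+m, m)` subsets of size `m`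
(one common subset for the two parties). -/
def uniformInput {n m d : ℕ} {E : Type*}
    (ρ : Matrix (ABE (Fin (n + m)) d E) (ABE (Fin (n + m)) d E) ℂ) :
    Matrix (SampleSet n m × ABE (Fin (n + m)) d E) (SampleSet n m × ABE (Fin (n + m)) d E) ℂ :=
  Matrix.diagonal (fun _ : SampleSet n m => (1 / ((n + m).choose m : ℂ))) ⊗ₖ ρ

/-- The operator `⟨t|_T ⊗ ⟨x_{q_A}|_{A_t} ⊗ ⟨x_{q_B}|_{B_t} ⊗ I`, which maps `T ⊗ A ⊗ B ⊗ E` to the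
unmeasured part of `A ⊗ B ⊗ E`. -/
def outcomeOp {n m d : ℕ} {E : Type*} [DecidableEq E] (X : QBasis d) (t : SampleSet n m)
    (qA qB : Word (Sampled t) d) :
    Matrix (ABE (Rest t) d E) (SampleSet n m × ABE (Fin (n + m)) d E) ℂ :=
  fun i j =>
    if j.1 = t ∧ (fun k : Rest t => j.2.1 k.1) = i.1 ∧ (fun k : Rest t => j.2.2.1 k.1) = i.2.1 ∧
        j.2.2.2 = i.2.2 then
      star (prodKet X qA fun k => j.2.1 k.1) * star (prodKet X qB fun k => j.2.2.1 k.1)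
    else 0

/-- Unnormalized post-measurement state for the outcome `(t, q_A, q_B)`. -/
def unnormalizedState {n m d : ℕ} {E : Type*} [Fintype E] [DecidableEq E] (X : QBasis d)
    (ρ : Matrix (SampleSet n m × ABE (Fin (n + m)) d E)
      (SampleSet n m × ABE (Fin (n + m)) d E) ℂ)
    (t : SampleSet n m) (qA qB : Word (Sampled t) d) :
    Matrix (ABE (Rest t) d E) (ABE (Rest t) d E) ℂ :=
  outcomeOp (E := E) X t qA qB * ρ * Matrix.conjTranspose (outcomeOp (E := E) X t qA qB)

/-- Probability that the experiment `Exp(ρ_TABE, X)` outputs `(t, q_A, q_B)`. -/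
def outcomeProb {n m d : ℕ} {E : Type*} [Fintype E] [DecidableEq E] (X : QBasis d)
    (ρ : Matrix (SampleSet n m × ABE (Fin (n + m)) d E)
      (SampleSet n m × ABE (Fin (n + m)) d E) ℂ)
    (t : SampleSet n m) (qA qB : Word (Sampled t) d) : ℝ :=
  (unnormalizedState X ρ t qA qB).trace.re

/-- Post-measurement state `ρ_ABE(t, q_A, q_B)` that the experiment outputs (it only matters for
outcomes of nonzero probability). -/
def postState {n m d : ℕ} {E : Type*} [Fintype E] [DecidableEq E] (X : QBasis d)
    (ρ : Matrix (SampleSet n m × ABE (Fin (n + m)) d E)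
      (SampleSet n m × ABE (Fin (n + m)) d E) ℂ)
    (t : SampleSet n m) (qA qB : Word (Sampled t) d) :
    Matrix (ABE (Rest t) d E) (ABE (Rest t) d E) ℂ :=
  (((outcomeProb X ρ t qA qB)⁻¹ : ℝ) : ℂ) • unnormalizedState X ρ t qA qB

open Classical in
/-- Probability, in the experiment `Exp(ρ_TABE, X)`, of an event of the output. -/
def experimentProb {n m d : ℕ} {E : Type*} [Fintype E] [DecidableEq E] (X : QBasis d)
    (ρ : Matrix (SampleSet n m × ABE (Fin (n + m)) d E)
      (SampleSet n m × ABE (Fin (n + m)) d E) ℂ)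
    (event : (t : SampleSet n m) → Word (Sampled t) d → Word (Sampled t) d → Prop) : ℝ :=
  ∑ t, ∑ qA, ∑ qB, if event t qA qB then outcomeProb X ρ t qA qB else 0

/-- `H_min^s(A_Z|E)` for a state on the remaining `A`, `B` and `E` systems: `B` is traced out and `A`
is measured in the basis `Z`. -/
def smoothMinEntropyAZ {κ E : Type*} [Fintype κ] [DecidableEq κ] [Fintype E] [DecidableEq E] {d : ℕ}
    (s : ℝ) (Z : QBasis d) (ρ : Matrix (ABE κ d E) (ABE κ d E) ℂ) : EReal :=
  smoothMinEntropy s (measureA Z (traceOutB ρ))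

end QSampling

end

noncomputable section

namespace QSampling

open Matrix

/-! ### Sampling without replacement -/

/-! In the product basis of X the experiment is classical. The diagonal of `ρ` in that basis is a
probability distribution on pairs of words, `t` is a uniform sample independent of the pair, and
measuring the sampled qudits selects a block of the matrix.

For every fixed pair of words, sampling without replacement (`sum_powersetCard_exp_le`,
`card_filter_sampling_le`) shows that, except with probability 2 exp(-L), where L = ln(4/ε²), the
unsampled positions have Hamming distance and count of `b*` at most `δ` above those observed.
Averaging over pairs and applying Markov's inequality (`experimentProb_le_of_sampling`), for most
outcomes the post-measurement state has weight at most η² outside the typical set of pairs (a, b).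
The projection to the span of this set, renormalized, then lies within 2η + 2η² of the original
state in trace norm.

The projected state has large min-entropy for two reasons. For fixed b, the typical words a lie in a
Hamming ball around b, so at most d^(n H̄) of them interfere (`card_hammingBall_le`); by
Cauchy–Schwarz a coherent superposition of M terms is at most M times the incoherent mixture. Each
squared amplitude |⟨z|x_a⟩|² is a product of single-qudit overlaps in which the exceptional value
2^(-γ̂) can occur only where a has the letter `b*`; a bound on the number of such positions bounds
the product (`norm_sq_overlap_word_le`). The operator inequality
`posSemidef_one_kronecker_restrictE_sub` combines both estimates, and
`le_smoothMinEntropy_measureTrace` adds the smoothing. -/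

/-- Hoeffding's lemma for the uniform distribution on a finite set. -/
theorem sum_exp_le_of_mem_Icc {ι : Type*} (U : Finset ι) (hU : U.Nonempty) (v : ι → ℝ)
    (hv : ∀ i ∈ U, v i ∈ Set.Icc (0 : ℝ) 1) (c : ℝ) :
    ∑ x ∈ U, Real.exp (c * v x) ≤
      U.card * Real.exp (c * ((∑ x ∈ U, v x) / U.card) + c ^ 2 / 8) := by
  classical
  let _ : MeasurableSpace U := ⊤
  have : Nonempty U := hU.to_subtype
  have hc0 : (0 : ℝ) < U.card := by exact_mod_cast hU.card_pos
  let μ := (PMF.uniformOfFintype U).toMeasure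
  have hint : ∀ f : U → ℝ, ∫ a, f a ∂μ = (∑ x : U, f x) / U.card := by
    intro f
    rw [PMF.integral_eq_sum, Finset.sum_div]
    refine Finset.sum_congr rfl fun x _ => ?_
    simp [PMF.uniformOfFintype_apply, div_eq_inv_mul]
  -- A variable with values in [0, 1] is sub-Gaussian with parameter 1/4 after centering, whence `c
  -- ^ 2 / 8`.
  have h := (ProbabilityTheory.hasSubgaussianMGF_of_mem_Icc (μ := μ)
    (X := fun x : U => v x) (a := 0) (b := 1) (measurable_from_top.aemeasurable)
    (MeasureTheory.ae_of_all _ fun x => hv x x.2)).mgf_le c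
  rw [ProbabilityTheory.mgf, hint, hint, Finset.sum_coe_sort U v,
    Finset.sum_coe_sort U (fun x => Real.exp (c * (v x - (∑ x ∈ U, v x) / U.card))),
    div_le_iff₀ hc0] at h
  have h2 : ∑ x ∈ U, Real.exp (c * v x) = Real.exp (c * ((∑ x ∈ U, v x) / U.card)) *
      ∑ x ∈ U, Real.exp (c * (v x - (∑ x ∈ U, v x) / U.card)) := by
    rw [Finset.mul_sum]
    refine Finset.sum_congr rfl fun x _ => ?_
    rw [← Real.exp_add]
    ring_nf
  rw [h2, Real.exp_add]
  refine (mul_le_mul_of_nonneg_left h (Real.exp_pos _).le).trans_eq ?_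
  norm_num
  ring_nf

/-- Double counting of pairs (t, x) with x in t: a sample of size m + 1 with a marked element is a
first draw x followed by a sample of size m from the rest. This is the induction step of Serfling's
bound. -/
theorem sum_powersetCard_succ_mul {ι R : Type*} [DecidableEq ι] [CommSemiring R] (U : Finset ι)
    (m : ℕ) (g : Finset ι → R) :
    ((m : R) + 1) * ∑ t ∈ U.powersetCard (m + 1), g t =
      ∑ x ∈ U, ∑ t ∈ (U.erase x).powersetCard m, g (insert x t) := by
  have h1 : ((m : R) + 1) * ∑ t ∈ U.powersetCard (m + 1), g t =
      ∑ t ∈ U.powersetCard (m + 1), ∑ _x ∈ t, g t := by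
    rw [Finset.mul_sum]
    refine Finset.sum_congr rfl fun t ht => ?_
    rw [Finset.sum_const, (Finset.mem_powersetCard.1 ht).2]
    simp
  rw [h1, Finset.sum_sigma', Finset.sum_sigma']
  refine Finset.sum_bij' (fun p _ => ⟨p.2, p.1.erase p.2⟩) (fun p _ => ⟨insert p.1 p.2, p.1⟩)
    ?_ ?_ ?_ ?_ ?_
  · rintro ⟨t, x⟩ h
    simp only [Finset.mem_sigma, Finset.mem_powersetCard] at h ⊢
    exact ⟨h.1.1 h.2, Finset.erase_subset_erase _ h.1.1, by
      rw [Finset.card_erase_of_mem h.2, h.1.2]; rfl⟩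
  · rintro ⟨x, t⟩ h
    simp only [Finset.mem_sigma, Finset.mem_powersetCard] at h ⊢
    have hx : x ∉ t := fun hx => Finset.notMem_erase x U (h.2.1 hx)
    exact ⟨⟨Finset.insert_subset h.1 (h.2.1.trans (Finset.erase_subset _ _)), by
      rw [Finset.card_insert_of_notMem hx, h.2.2]⟩, Finset.mem_insert_self _ _⟩
  · rintro ⟨t, x⟩ h
    simp only [Finset.mem_sigma] at h
    simp [Finset.insert_erase h.2]
  · rintro ⟨x, t⟩ h
    simp only [Finset.mem_sigma, Finset.mem_powersetCard] at h ⊢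
    have hx : x ∉ t := fun hx => Finset.notMem_erase x U (h.2.1 hx)
    simp [Finset.erase_insert hx]
  · rintro ⟨t, x⟩ h
    simp only [Finset.mem_sigma] at h
    simp [Finset.insert_erase h.2]

/-- Serfling's bound on the moment generating function of the sum of a sample that is drawn without
replacement. -/
theorem sum_powersetCard_exp_le {ι : Type*} (l : ℝ) (v : ι → ℝ)
    (hv : ∀ i, v i ∈ Set.Icc (0 : ℝ) 1) (m : ℕ) (U : Finset ι) (hm : m ≤ U.card) :
    ∑ t ∈ U.powersetCard m, Real.exp (l * ∑ x ∈ t, v x) ≤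
      (U.card.choose m : ℝ) * Real.exp (l * m * ((∑ x ∈ U, v x) / U.card) +
        l ^ 2 / 8 * (m * (U.card - m + 1) / U.card)) := by
  classical
  induction m generalizing U with
  | zero => simp
  | succ m ih =>
    obtain ⟨M, hM⟩ : ∃ M, U.card = M + 1 := ⟨U.card - 1, by omega⟩
    have hU : U.Nonempty := Finset.card_pos.1 (by omega)
    set S := ∑ x ∈ U, v x with hS
    have hmM : (m : ℝ) ≤ M := by exact_mod_cast (by omega : m ≤ M)
    have key : ((m : ℝ) + 1) * ∑ t ∈ U.powersetCard (m + 1), Real.exp (l * ∑ x ∈ t, v x) ≤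
        ((m : ℝ) + 1) * ((U.card.choose (m + 1) : ℝ) *
          Real.exp (l * (m + 1 : ℕ) * (S / U.card) +
            l ^ 2 / 8 * ((m + 1 : ℕ) * (U.card - (m + 1 : ℕ) + 1) / U.card))) := by
      rw [sum_powersetCard_succ_mul]
      -- After the first draw x the remaining population has mean (S - v x) / M, so v x enters the
      -- exponent directly with `l` and through this mean with -l m / M.
      set c : ℝ := l * (1 - m / M) with hc
      calc ∑ x ∈ U, ∑ t ∈ (U.erase x).powersetCard m, Real.exp (l * ∑ y ∈ insert x t, v y)
          ≤ ∑ x ∈ U, (M.choose m : ℝ) * Real.exp (l * m * (S / M) +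
              l ^ 2 / 8 * (m * (M - m + 1) / M)) * Real.exp (c * v x) := by
            refine Finset.sum_le_sum fun x hx => ?_
            have hcard : (U.erase x).card = M := by rw [Finset.card_erase_of_mem hx, hM]; rfl
            have h1 : ∑ t ∈ (U.erase x).powersetCard m, Real.exp (l * ∑ y ∈ insert x t, v y) =
                Real.exp (l * v x) *
                  ∑ t ∈ (U.erase x).powersetCard m, Real.exp (l * ∑ y ∈ t, v y) := by
              rw [Finset.mul_sum]
              refine Finset.sum_congr rfl fun t ht => ?_
              rw [Finset.sum_insert fun hx' =>
                Finset.notMem_erase x U ((Finset.mem_powersetCard.1 ht).1 hx'), ← Real.exp_add]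
              ring_nf
            rw [h1]
            refine (mul_le_mul_of_nonneg_left (ih (U.erase x) (by omega))
              (Real.exp_pos _).le).trans_eq ?_
            rw [hcard, Finset.sum_erase_eq_sub hx, ← hS, mul_left_comm, ← Real.exp_add,
              mul_assoc (M.choose m : ℝ), ← Real.exp_add]
            congr 2
            rw [hc]
            ring
        _ = (M.choose m : ℝ) * Real.exp (l * m * (S / M) +
              l ^ 2 / 8 * (m * (M - m + 1) / M)) * ∑ x ∈ U, Real.exp (c * v x) := by
            rw [Finset.mul_sum]
        _ ≤ (M.choose m : ℝ) * Real.exp (l * m * (S / M) + l ^ 2 / 8 * (m * (M - m + 1) / M)) *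
              (U.card * Real.exp (c * (S / U.card) + c ^ 2 / 8)) :=
            mul_le_mul_of_nonneg_left (sum_exp_le_of_mem_Icc U hU v (fun i _ => hv i) c)
              (by positivity)
        _ = (((M + 1) * M.choose m : ℕ) : ℝ) * Real.exp (l * m * (S / M) +
              l ^ 2 / 8 * (m * (M - m + 1) / M) + (c * (S / U.card) + c ^ 2 / 8)) := by
            rw [Real.exp_add (l * m * (S / M) + _), hM]
            push_cast
            ring
        _ ≤ _ := by
            rw [Nat.add_one_mul_choose_eq, ← hM, ← mul_assoc]
            have e : (((U.card.choose (m + 1)) * (m + 1) : ℕ) : ℝ) =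
              ((m : ℝ) + 1) * (U.card.choose (m + 1) : ℝ) := by push_cast; ring
            rw [e]
            refine mul_le_mul_of_nonneg_left (Real.exp_le_exp.2 ?_) (by positivity)
            rw [hM]
            push_cast
            -- For M = 0 nothing remains after the first draw, and the quotients by M are 0 by
            -- convention.
            rcases Nat.eq_zero_or_pos M with h0 | h0
            · have : m = 0 := by omega
              subst this
              subst h0
              simp [hc]
            · have hM0 : (0 : ℝ) < M := by exact_mod_cast h0
              have e1 : l * m * (S / M) + c * (S / (M + 1)) = l * (m + 1) * (S / (M + 1)) := by
                rw [hc]; field_simp; ring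
              -- Recursion of the variance terms: Hoeffding's term for the first draw plus the bound
              -- for the other m draws stays below the claimed bound for m + 1 draws.
              have e2 : (1 - m / M : ℝ) ^ 2 + m * (M - m + 1) / M ≤
                  (m + 1) * (M + 1 - (m + 1) + 1) / (M + 1) := by
                have : (m + 1) * (M + 1 - (m + 1) + 1) / (M + 1) -
                  ((1 - m / M : ℝ) ^ 2 + m * (M - m + 1) / M) =
                    (M - m) * m / (M ^ 2 * (M + 1)) := by
                  field_simp; ring
                have h3 : 0 ≤ (M - m) * m / ((M : ℝ) ^ 2 * (M + 1)) :=
                  div_nonneg (mul_nonneg (by linarith) (by positivity)) (by positivity)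
                linarith
              have e3 : c ^ 2 / 8 = l ^ 2 / 8 * (1 - m / M) ^ 2 := by rw [hc]; ring
              have e4 := mul_le_mul_of_nonneg_left e2 (by positivity : 0 ≤ l ^ 2 / 8)
              rw [mul_add] at e4
              linarith
    exact le_of_mul_le_mul_left key (by positivity)

/-- A one-sided tail bound for the difference between the averages of a population outside of and
inside a uniformly random sample. -/
theorem card_filter_sampling_le {n m : ℕ} (hm : 1 ≤ m) (hmn : m ≤ n) (v : Fin (n + m) → ℝ)
    (hv : ∀ i, v i ∈ Set.Icc (0 : ℝ) 1) {L δ : ℝ} (hδ0 : 0 ≤ δ)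
    (hδ : ((m : ℝ) + n + 2) * L / ((m : ℝ) * ((m : ℝ) + n)) ≤ δ ^ 2) :
    (((Finset.univ.powersetCard m).filter fun t : Finset (Fin (n + m)) =>
      (∑ i ∈ t, v i) / m + δ < (∑ i ∈ tᶜ, v i) / n).card : ℝ) ≤
      ((n + m).choose m : ℝ) * Real.exp (-L) := by
  classical
  have hm0 : (0 : ℝ) < m := by exact_mod_cast hm
  have hmn' : (m : ℝ) ≤ n := by exact_mod_cast hmn
  have hn0 : (0 : ℝ) < n := hm0.trans_le hmn'
  set S := ∑ i, v i with hS
  -- Minimizer of the Chernoff exponent -l δ n m / (n + m) + (l² / 8) m (n + 1) / (n + m).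
  set l : ℝ := 4 * δ * n / (n + 1) with hl
  have hl0 : 0 ≤ l := by positivity
  have h1 := sum_powersetCard_exp_le (-l) v hv m Finset.univ (by simp)
  simp only [Finset.card_univ, Fintype.card_fin, ← hS] at h1
  push_cast at h1
  set w : ℝ := l * (m * S / (n + m)) - l * (δ * n * m / (n + m)) with hw
  have h2 : (((Finset.univ.powersetCard m).filter fun t : Finset (Fin (n + m)) =>
      (∑ i ∈ t, v i) / m + δ < (∑ i ∈ tᶜ, v i) / n).card : ℝ) * Real.exp (-w) ≤
      ∑ t ∈ (Finset.univ : Finset (Fin (n + m))).powersetCard m,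
        Real.exp (-l * ∑ x ∈ t, v x) := by
    rw [← nsmul_eq_mul, ← Finset.sum_const]
    refine (Finset.sum_le_sum ?_).trans (Finset.sum_le_sum_of_subset_of_nonneg
      (Finset.filter_subset _ _) fun _ _ _ => (Real.exp_pos _).le)
    intro t ht
    rw [Finset.mem_filter] at ht
    refine Real.exp_le_exp.2 ?_
    have hc : ∑ i ∈ tᶜ, v i = S - ∑ i ∈ t, v i := by
      rw [hS, ← Finset.sum_add_sum_compl t v]; ring
    have ht2 := ht.2
    rw [hc] at ht2
    set s := ∑ i ∈ t, v i
    have h3 : s ≤ m * S / (n + m) - δ * n * m / (n + m) := by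
      rw [div_add' _ _ _ hm0.ne', div_lt_div_iff₀ hm0 hn0] at ht2
      rw [← sub_div, le_div_iff₀ (by positivity)]
      nlinarith
    have := mul_le_mul_of_nonneg_left h3 hl0
    rw [hw]
    linarith
  have h3 := h2.trans h1
  rw [← le_div_iff₀ (Real.exp_pos _), mul_div_assoc, ← Real.exp_sub] at h3
  refine h3.trans (mul_le_mul_of_nonneg_left (Real.exp_le_exp.2 ?_) (by positivity))
  have e1 : -l * m * (S / (n + m)) + (-l) ^ 2 / 8 * (m * (n + m - m + 1) / (n + m)) - -w =
      -(2 * n ^ 2 * m / ((n + 1) * (n + m)) * δ ^ 2) := by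
    rw [hw, hl]; field_simp; ring
  rw [e1, neg_le_neg_iff]
  have e2 : L ≤ m * (m + n) / (m + n + 2) * δ ^ 2 := by
    rw [div_le_iff₀ (by positivity)] at hδ
    rw [div_mul_eq_mul_div, le_div_iff₀ (by positivity)]
    linarith
  refine e2.trans (mul_le_mul_of_nonneg_right ?_ (by positivity))
  rw [div_le_div_iff₀ (by positivity) (by positivity)]
  -- The optimal exponent is at least the simpler one in the definition of δ exactly because m ≤ n;
  -- equality holds for m = n.
  have e3 : (m + n : ℝ) ^ 2 * (n + 1) ≤ 2 * n ^ 2 * (m + n + 2) := by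
    have : 2 * n ^ 2 * (m + n + 2) - (m + n : ℝ) ^ 2 * (n + 1) =
      (n - m) * ((n + 1) * (m + n) + 2 * n) := by ring
    have : 0 ≤ (n - m : ℝ) * ((n + 1) * (m + n) + 2 * n) :=
      mul_nonneg (by linarith) (by positivity)
    linarith
  calc (m : ℝ) * (m + n) * ((n + 1) * (n + m)) = m * ((m + n) ^ 2 * (n + 1)) := by ring
    _ ≤ m * (2 * n ^ 2 * (m + n + 2)) := mul_le_mul_of_nonneg_left e3 hm0.le
    _ = _ := by ring

/-! ### Hamming balls -/

/-- The number of words within relative Hamming distance `x` of a given word. -/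
theorem card_hammingBall_le {κ : Type*} [Fintype κ] [DecidableEq κ] [Nonempty κ] {d : ℕ}
    (hd : 2 ≤ d) (b : Word κ d) {x : ℝ} (hx : 0 ≤ x) :
    ((Finset.univ.filter fun a : Word κ d => relHammingDist a b ≤ x).card : ℝ) ≤
      (d : ℝ) ^ ((Fintype.card κ : ℝ) * extEntropy d x) := by
  set N := Fintype.card κ with hN
  have hN0 : (0 : ℝ) < N := by exact_mod_cast Fintype.card_pos
  have hd0 : (0 : ℝ) < d := by exact_mod_cast (by omega : 0 < d)
  have hd1 : (1 : ℝ) < d := by exact_mod_cast (by omega : 1 < d)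
  by_cases hx1 : x ≤ 1 - 1 / (d : ℝ)
  swap
  · rw [extEntropy, if_neg (not_lt.2 hx), if_neg hx1, mul_one, Real.rpow_natCast]
    refine (Nat.cast_le.2 (Finset.card_filter_le _ _)).trans ?_
    simp [hN]
  rw [extEntropy, if_neg (not_lt.2 hx), if_pos hx1]
  -- Radius 0 is separate since the probability `p` below has to be positive.
  rcases hx.eq_or_lt with rfl | hx0
  · have h0 : dEntropy d 0 = 0 := by simp [dEntropy]
    rw [h0, mul_zero, Real.rpow_zero]
    have : (Finset.univ.filter fun a : Word κ d => relHammingDist a b ≤ 0) ⊆ {b} := by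
      intro a ha
      replace ha := (Finset.mem_filter.1 ha).2
      rw [relHammingDist, div_le_iff₀ hN0, zero_mul] at ha
      have h1 : (Finset.univ.filter fun k => a k ≠ b k).card = 0 := by
        exact_mod_cast le_antisymm ha (Nat.cast_nonneg _)
      rw [Finset.card_eq_zero, Finset.filter_eq_empty_iff] at h1
      simp only [Finset.mem_singleton]
      ext k
      have := h1 (Finset.mem_univ k)
      simp only [ne_eq, not_not] at this
      rw [this]
    exact_mod_cast Finset.card_le_card this
  have hy0 : 0 < 1 - x := by
    have : 0 < 1 / (d : ℝ) := by positivity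
    linarith
  have hdm : (0 : ℝ) < d - 1 := by linarith
  -- Random word that agrees with b at each position with probability 1 - x and takes every other
  -- letter with probability p. As p ≤ 1 - x is equivalent to x ≤ 1 - 1/d, the least likely words in
  -- the ball are those near its boundary; all have probability at least `w` = d^(-N H_d(x)), and
  -- the total is 1.
  set p : ℝ := x / (d - 1) with hp
  have hp0 : 0 < p := by positivity
  have hpx : p ≤ 1 - x := by
    rw [hp, div_le_iff₀ hdm]
    have h := mul_le_mul_of_nonneg_right hx1 hd0.le
    rw [sub_mul, div_mul_cancel₀ _ hd0.ne'] at h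
    linarith
  have hsum : ∑ a : Word κ d, ∏ k, (if a k = b k then 1 - x else p) = 1 := by
    rw [← Fintype.prod_sum (f := fun k j => if j = b k then 1 - x else p)]
    refine Finset.prod_eq_one fun k _ => ?_
    rw [← Finset.add_sum_erase _ _ (Finset.mem_univ (b k)), if_pos rfl,
      Finset.sum_congr rfl (g := fun _ => p) fun j hj => if_neg (Finset.ne_of_mem_erase hj),
      Finset.sum_const, Finset.card_erase_of_mem (Finset.mem_univ _), Finset.card_univ,
      Fintype.card_fin, nsmul_eq_mul, Nat.cast_sub (by omega), Nat.cast_one, hp]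
    field_simp
    ring
  set w : ℝ := (1 - x) ^ ((N : ℝ) * (1 - x)) * p ^ ((N : ℝ) * x) with hw
  have hw0 : 0 < w := by positivity
  have hwe : w = (d : ℝ) ^ (-((N : ℝ) * dEntropy d x)) := by
    have e : ∀ y : ℝ, 0 < y → ∀ z : ℝ, y ^ z = (d : ℝ) ^ (Real.logb d y * z) := by
      intro y hy z
      rw [Real.rpow_mul hd0.le, Real.rpow_logb hd0 hd1.ne' hy]
    rw [hw, e _ hy0, e _ hp0, ← Real.rpow_add hd0, hp, Real.logb_div hx0.ne' hdm.ne', dEntropy]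
    congr 1
    ring
  have hle : ∀ a ∈ Finset.univ.filter fun a : Word κ d => relHammingDist a b ≤ x,
      w ≤ ∏ k, (if a k = b k then 1 - x else p) := by
    intro a ha
    replace ha := (Finset.mem_filter.1 ha).2
    rw [relHammingDist, div_le_iff₀ hN0] at ha
    rw [Finset.prod_ite, Finset.prod_const, Finset.prod_const]
    have hc := Finset.card_filter_add_card_filter_not
      (s := (Finset.univ : Finset κ)) (fun k => a k = b k)
    set h := (Finset.univ.filter fun k => a k ≠ b k).card with hh
    set g := (Finset.univ.filter fun k => a k = b k).card
    have hgh : (g : ℝ) = N - h := by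
      have : g + h = N := by rw [hc, Finset.card_univ]
      rw [← this]; push_cast; ring
    change w ≤ (1 - x) ^ g * p ^ h
    rw [← Real.rpow_natCast, ← Real.rpow_natCast, hgh]
    have e1 : (1 - x) ^ ((N : ℝ) - h) = (1 - x) ^ ((N : ℝ) * (1 - x)) * (1 - x) ^ (N * x - h) := by
      rw [← Real.rpow_add hy0]; ring_nf
    have e2 : p ^ ((N : ℝ) * x) = p ^ (N * x - (h : ℝ)) * p ^ (h : ℝ) := by
      rw [← Real.rpow_add hp0]; ring_nf
    rw [hw, e1, e2, mul_assoc]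
    refine mul_le_mul_of_nonneg_left (mul_le_mul_of_nonneg_right ?_ (by positivity))
      (by positivity)
    exact Real.rpow_le_rpow hp0.le hpx (by linarith)
  have hfin := (Finset.card_nsmul_le_sum _ _ _ hle).trans
    ((Finset.sum_le_sum_of_subset_of_nonneg (Finset.filter_subset _ _) fun a _ _ =>
      Finset.prod_nonneg fun k _ => by split_ifs <;> positivity).trans_eq hsum)
  rw [nsmul_eq_mul, hwe, Real.rpow_neg hd0.le, ← div_eq_mul_inv,
    div_le_one (by positivity)] at hfin
  exact hfin

/-! ### Trace norm -/

/-- `Dᴴ * D` has the characteristic polynomial of the diagonal matrix of the squared eigenvalues of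
D. Comparing multisets of roots makes the order in which eigenvalues are listed irrelevant. -/
theorem traceNorm_eq_sum_abs_eigenvalues {ι : Type*} [Fintype ι] [DecidableEq ι]
    {D : Matrix ι ι ℂ} (hD : D.IsHermitian) : traceNorm D = ∑ i, |hD.eigenvalues i| := by
  set V : Matrix ι ι ℂ := (hD.eigenvectorUnitary).1 with hVdef
  have hV : Vᴴ * V = 1 := (mem_unitaryGroup_iff'.1 hD.eigenvectorUnitary.2 :)
  have hs : D = V * diagonal (fun i => (hD.eigenvalues i : ℂ)) * Vᴴ := by
    conv_lhs => rw [hD.spectral_theorem, Unitary.conjStarAlgAut_apply]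
    rfl
  have h2 : Dᴴ * D = V * diagonal (fun i => ((hD.eigenvalues i ^ 2 : ℝ) : ℂ)) * Vᴴ := by
    rw [hD.eq]
    calc D * D = V * diagonal (fun i => (hD.eigenvalues i : ℂ)) * (Vᴴ * V) *
          diagonal (fun i => (hD.eigenvalues i : ℂ)) * Vᴴ := by
            conv_lhs => rw [hs]
            simp only [Matrix.mul_assoc]
      _ = _ := by
        rw [hV, Matrix.mul_one, Matrix.mul_assoc V, diagonal_mul_diagonal]
        congr 3
        ext i
        push_cast
        ring
  have hc : (Dᴴ * D).charpoly = (diagonal fun i => ((hD.eigenvalues i ^ 2 : ℝ) : ℂ)).charpoly := by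
    rw [h2, Matrix.mul_assoc, charpoly_mul_comm, Matrix.mul_assoc, hV, Matrix.mul_one]
  have hr := (isHermitian_conjTranspose_mul_self D).roots_charpoly_eq_eigenvalues
  have hr' := Polynomial.roots_multiset_prod_X_sub_C
    (Finset.univ.val.map fun i => ((hD.eigenvalues i ^ 2 : ℝ) : ℂ))
  rw [Multiset.map_map] at hr'
  rw [hc, charpoly_diagonal, Finset.prod_eq_multiset_prod] at hr
  replace hr := hr'.symm.trans hr
  have hm := congrArg (fun s : Multiset ℂ => (s.map fun z => √z.re).sum) hr
  simp only [Multiset.map_map, Function.comp_apply, Complex.ofReal_re, Real.sqrt_sq_eq_abs] at hm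
  exact hm.symm

/-- In an eigenbasis of D, -Q ≤ D ≤ Q bounds each |eigenvalue| by the diagonal entry of Q, and these
entries sum to the trace. A dominating Q is thus enough for a trace distance estimate. -/
theorem traceNorm_le_of_posSemidef {ι : Type*} [Fintype ι] [DecidableEq ι]
    {D Q : Matrix ι ι ℂ} (hD : D.IsHermitian) (h1 : (Q - D).PosSemidef)
    (h2 : (Q + D).PosSemidef) : traceNorm D ≤ Q.trace.re := by
  rw [traceNorm_eq_sum_abs_eigenvalues hD]
  set V : Matrix ι ι ℂ := (hD.eigenvectorUnitary).1 with hVdef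
  have hV : Vᴴ * V = 1 := (mem_unitaryGroup_iff'.1 hD.eigenvectorUnitary.2 :)
  have hV' : V * Vᴴ = 1 := (mem_unitaryGroup_iff.1 hD.eigenvectorUnitary.2 :)
  have hs : D = V * diagonal (fun i => (hD.eigenvalues i : ℂ)) * Vᴴ := by
    conv_lhs => rw [hD.spectral_theorem, Unitary.conjStarAlgAut_apply]
    rfl
  have hd : Vᴴ * D * V = diagonal fun i => (hD.eigenvalues i : ℂ) := by
    nth_rewrite 1 [hs]
    calc _ = (Vᴴ * V) * diagonal (fun i => (hD.eigenvalues i : ℂ)) * (Vᴴ * V) := by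
          simp only [Matrix.mul_assoc]
      _ = _ := by rw [hV, Matrix.mul_one, Matrix.one_mul]
  have ht : Q.trace.re = ∑ i, ((Vᴴ * Q * V) i i).re := by
    have : Q.trace = (Vᴴ * Q * V).trace := by
      rw [Matrix.mul_assoc, trace_mul_comm, Matrix.mul_assoc, hV', Matrix.mul_one]
    rw [this, trace, Complex.re_sum]
    rfl
  rw [ht]
  refine Finset.sum_le_sum fun i _ => abs_le'.2 ⟨?_, ?_⟩
  · have := (Complex.le_def.1 ((h1.conjTranspose_mul_mul_same V).diag_nonneg (i := i))).1
    rw [Matrix.mul_sub, Matrix.sub_mul, hd] at this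
    simpa using this
  · have := (Complex.le_def.1 ((h2.conjTranspose_mul_mul_same V).diag_nonneg (i := i))).1
    rw [Matrix.mul_add, Matrix.add_mul, hd] at this
    simp at this
    linarith

/-! ### Measuring `A` and discarding `B` -/

section MeasureTrace

variable {α A B E : Type*} [Fintype α] [DecidableEq α] [Fintype A] [DecidableEq A] [Fintype B]
  [DecidableEq B] [Fintype E] [DecidableEq E]

/-- The state obtained from `R` by measuring `A`, with the amplitudes `O z a` of the outcomes, and
tracing out `B`. -/
def measureTrace (O : Matrix α A ℂ) (R : Matrix (A × B × E) (A × B × E) ℂ) :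
    Matrix (α × E) (α × E) ℂ :=
  fun i j => if i.1 = j.1 then
    ∑ b, ∑ a, ∑ a', O i.1 a * star (O i.1 a') * R (a, b, i.2) (a', b, j.2) else 0

/-- The operator `|z⟩⟨a, b| ⊗ I_E`. -/
def transition (E : Type*) [DecidableEq E] (z : α) (a : A) (b : B) : Matrix (α × E) (A × B × E) ℂ :=
  fun i j => if i.1 = z ∧ j = (a, b, i.2) then 1 else 0

omit [Fintype α] in
theorem transition_mul_mul_apply (z z' : α) (a a' : A) (b b' : B)
    (R : Matrix (A × B × E) (A × B × E) ℂ) (i j : α × E) :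
    (transition E z a b * R * (transition E z' a' b')ᴴ) i j =
      if i.1 = z ∧ j.1 = z' then R (a, b, i.2) (a', b', j.2) else 0 := by
  simp only [Matrix.mul_apply, transition, conjTranspose_apply]
  by_cases h1 : i.1 = z <;> by_cases h2 : j.1 = z' <;> simp [h1, h2]

/-- The operator `|z⟩⟨o_z, b| ⊗ I_E`. -/
def measureOp (E : Type*) [DecidableEq E] (O : Matrix α A ℂ) (z : α) (b : B) :
    Matrix (α × E) (A × B × E) ℂ :=
  ∑ a, O z a • transition E z a b

/-- The Kraus form of the map, from which positivity is immediate. -/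
theorem measureTrace_eq_sum (O : Matrix α A ℂ) (R : Matrix (A × B × E) (A × B × E) ℂ) :
    measureTrace O R = ∑ z, ∑ b : B, measureOp E O z b * R * (measureOp E O z b)ᴴ := by
  ext i j
  simp only [measureTrace, measureOp, conjTranspose_sum, conjTranspose_smul, Matrix.sum_mul,
    Matrix.mul_sum, Matrix.smul_mul, Matrix.mul_smul, Matrix.sum_apply, Matrix.smul_apply,
    transition_mul_mul_apply, smul_eq_mul]
  by_cases h : i.1 = j.1
  · rw [if_pos h, Finset.sum_eq_single_of_mem i.1 (Finset.mem_univ _)]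
    · refine Finset.sum_congr rfl fun b _ => ?_
      rw [Finset.sum_comm]
      refine Finset.sum_congr rfl fun a' _ => ?_
      rw [Finset.mul_sum]
      refine Finset.sum_congr rfl fun a _ => ?_
      rw [if_pos ⟨rfl, h.symm⟩]
      ring
    · intro z _ hz
      simp [hz.symm]
  · rw [if_neg h]
    symm
    refine Finset.sum_eq_zero fun z _ => Finset.sum_eq_zero fun b _ =>
      Finset.sum_eq_zero fun a _ => ?_
    rw [Finset.sum_eq_zero, mul_zero]
    intro a' _
    rw [if_neg fun h' => h (h'.1.trans h'.2.symm), mul_zero]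

theorem measureTrace_posSemidef (O : Matrix α A ℂ) {R : Matrix (A × B × E) (A × B × E) ℂ}
    (hR : R.PosSemidef) : (measureTrace O R).PosSemidef := by
  rw [measureTrace_eq_sum]
  exact posSemidef_sum _ fun z _ => posSemidef_sum _ fun b _ => hR.mul_mul_conjTranspose_same _

omit [Fintype α] [DecidableEq A] [DecidableEq B] [Fintype E] [DecidableEq E] in
theorem measureTrace_add (O : Matrix α A ℂ) (R R' : Matrix (A × B × E) (A × B × E) ℂ) :
    measureTrace O (R + R') = measureTrace O R + measureTrace O R' := by
  ext i j
  simp only [measureTrace, Matrix.add_apply]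
  split_ifs
  · simp only [mul_add, Finset.sum_add_distrib]
  · simp

omit [Fintype α] [DecidableEq A] [DecidableEq B] [Fintype E] [DecidableEq E] in
theorem measureTrace_smul (O : Matrix α A ℂ) (c : ℂ) (R : Matrix (A × B × E) (A × B × E) ℂ) :
    measureTrace O (c • R) = c • measureTrace O R := by
  ext i j
  simp only [measureTrace, Matrix.smul_apply, smul_eq_mul]
  split_ifs
  · simp only [Finset.mul_sum, mul_left_comm c]
  · simp

omit [Fintype α] [DecidableEq A] [DecidableEq B] [Fintype E] [DecidableEq E] in
theorem measureTrace_sub (O : Matrix α A ℂ) (R R' : Matrix (A × B × E) (A × B × E) ℂ) :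
    measureTrace O (R - R') = measureTrace O R - measureTrace O R' := by
  rw [sub_eq_add_neg, ← neg_one_smul ℂ R', measureTrace_add, measureTrace_smul, neg_one_smul,
    sub_eq_add_neg]

omit [DecidableEq B] [DecidableEq E] in
theorem trace_measureTrace {O : Matrix α A ℂ} (hO : Oᴴ * O = 1)
    (R : Matrix (A × B × E) (A × B × E) ℂ) : (measureTrace O R).trace = R.trace := by
  have h : ∀ a a', ∑ z, O z a * star (O z a') = if a' = a then 1 else 0 := by
    intro a a'
    have := congrFun (congrFun hO a') a
    rw [Matrix.mul_apply, Matrix.one_apply] at this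
    rw [← this]
    exact Finset.sum_congr rfl fun z _ => by rw [conjTranspose_apply, mul_comm]
  simp only [trace, diag_apply, measureTrace, if_true, Fintype.sum_prod_type]
  calc _ = ∑ e, ∑ b, ∑ a, ∑ a', (∑ z, O z a * star (O z a')) * R (a, b, e) (a', b, e) := by
        rw [Finset.sum_comm]
        refine Finset.sum_congr rfl fun e _ => ?_
        rw [Finset.sum_comm]
        refine Finset.sum_congr rfl fun b _ => ?_
        rw [Finset.sum_comm]
        refine Finset.sum_congr rfl fun a _ => ?_
        rw [Finset.sum_comm]
        exact Finset.sum_congr rfl fun a' _ => (Finset.sum_mul _ _ _).symm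
    _ = ∑ e, ∑ b, ∑ a, R (a, b, e) (a, b, e) := by
        simp only [h, ite_mul, one_mul, zero_mul, Finset.sum_ite_eq', Finset.mem_univ, if_true]
    _ = _ := by
        rw [Finset.sum_comm, Finset.sum_congr rfl fun b _ => Finset.sum_comm, Finset.sum_comm]

/-! ### A lower bound on the smooth min-entropy -/

/-- The projector onto the span of the basis states whose `AB`-part lies in `S`. -/
def spanProj (S : Finset (A × B)) : Matrix (A × B × E) (A × B × E) ℂ :=
  diagonal fun i => if (i.1, i.2.1) ∈ S then 1 else 0

omit [Fintype A] [Fintype B] [Fintype E] in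
theorem spanProj_conjTranspose (S : Finset (A × B)) :
    (spanProj S : Matrix (A × B × E) (A × B × E) ℂ)ᴴ = spanProj S := by
  rw [spanProj, diagonal_conjTranspose]
  congr 1
  ext i
  simp only [Pi.star_apply]
  split_ifs <;> simp

omit [Fintype α] in
theorem transition_mul_spanProj (S : Finset (A × B)) (z : α) (a : A) (b : B) :
    transition E z a b * (spanProj S : Matrix (A × B × E) (A × B × E) ℂ) =
      if (a, b) ∈ S then transition E z a b else 0 := by
  ext i j
  rw [spanProj, mul_diagonal]
  by_cases h : j = (a, b, i.2)
  · subst h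
    split_ifs <;> simp
  · split_ifs <;> simp [transition, h]

/-- The Cauchy–Schwarz inequality for conjugates of a positive semidefinite matrix. -/
theorem posSemidef_card_smul_sum_sub {ι κ σ : Type*} [Fintype ι] [Fintype κ]
    {R : Matrix ι ι ℂ} (hR : R.PosSemidef) (s : Finset σ) (L : σ → Matrix κ ι ℂ) :
    ((s.card : ℂ) • ∑ a ∈ s, L a * R * (L a)ᴴ -
      (∑ a ∈ s, L a) * R * (∑ a ∈ s, L a)ᴴ).PosSemidef := by
  have h : (s.card : ℂ) • ∑ a ∈ s, L a * R * (L a)ᴴ - (∑ a ∈ s, L a) * R * (∑ a ∈ s, L a)ᴴ =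
      -- Polarization writes the difference as a sum of conjugates of R.
      (1 / 2 : ℂ) • ∑ a ∈ s, ∑ a' ∈ s, (L a - L a') * R * (L a - L a')ᴴ := by
    simp only [conjTranspose_sub, Matrix.sub_mul, Matrix.mul_sub, Finset.sum_sub_distrib,
      Finset.sum_const, conjTranspose_sum, Matrix.sum_mul, Matrix.mul_sum,
      ← Nat.cast_smul_eq_nsmul ℂ, ← Finset.smul_sum]
    rw [Finset.sum_comm (f := fun x y => L y * R * (L x)ᴴ)]
    module
  rw [h]
  refine PosSemidef.smul (posSemidef_sum _ fun a _ => posSemidef_sum _ fun a' _ =>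
    hR.mul_mul_conjTranspose_same _) ?_
  rw [Complex.le_def]
  norm_num

/-- The reduced operator on `E` of the restriction of `R` to `S`. -/
def restrictE (S : Finset (A × B)) (R : Matrix (A × B × E) (A × B × E) ℂ) : Matrix E E ℂ :=
  fun e e' => ∑ p ∈ S, R (p.1, p.2, e) (p.1, p.2, e')

omit [Fintype A] [DecidableEq A] [Fintype B] [DecidableEq B] [Fintype E] [DecidableEq E] in
theorem restrictE_posSemidef (S : Finset (A × B)) {R : Matrix (A × B × E) (A × B × E) ℂ}
    (hR : R.PosSemidef) : (restrictE S R).PosSemidef := by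
  have : restrictE S R = ∑ p ∈ S, R.submatrix (fun e => (p.1, p.2, e)) fun e => (p.1, p.2, e) := by
    ext e e'
    simp [restrictE, Matrix.sum_apply]
  rw [this]
  exact posSemidef_sum _ fun p _ => hR.submatrix _

theorem one_kronecker_restrictE (S : Finset (A × B)) (R : Matrix (A × B × E) (A × B × E) ℂ) :
    (1 : Matrix α α ℂ) ⊗ₖ restrictE S R =
      ∑ z, ∑ p ∈ S, transition E z p.1 p.2 * R * (transition E z p.1 p.2)ᴴ := by
  ext i j
  simp only [kroneckerMap_apply, Matrix.sum_apply, transition_mul_mul_apply, restrictE,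
    Matrix.one_apply]
  by_cases h : i.1 = j.1
  · rw [if_pos h, one_mul, Finset.sum_eq_single_of_mem i.1 (Finset.mem_univ _)]
    · simp [h]
    · intro z _ hz
      simp [hz.symm]
  · rw [if_neg h, zero_mul]
    symm
    refine Finset.sum_eq_zero fun z _ => Finset.sum_eq_zero fun p _ => ?_
    rw [if_neg fun h' => h (h'.1.trans h'.2.symm)]

/-- For each outcome z and each b, the measured projected state contains a coherent sum over the at
most M words a with (a, b) in S. Cauchy–Schwarz replaces it by M times the incoherent sum, where the
amplitudes enter only through |O z a|² ≤ μ; without amplitudes this sum is I ⊗ `restrictE S R`. -/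
theorem posSemidef_one_kronecker_restrictE_sub {O : Matrix α A ℂ}
    {R : Matrix (A × B × E) (A × B × E) ℂ} (hR : R.PosSemidef) (S : Finset (A × B)) {μ M : ℝ}
    (hμ : ∀ z, ∀ p ∈ S, ‖O z p.1‖ ^ 2 ≤ μ)
    (hM : ∀ b, ((Finset.univ.filter fun a => (a, b) ∈ S).card : ℝ) ≤ M) :
    (((M * μ : ℝ) : ℂ) • (1 : Matrix α α ℂ) ⊗ₖ restrictE S R -
      measureTrace O (spanProj S * R * spanProj S)).PosSemidef := by
  have h1 : measureTrace O (spanProj S * R * spanProj S) = ∑ z, ∑ b,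
      (∑ a ∈ Finset.univ.filter fun a => (a, b) ∈ S, O z a • transition E z a b :
        Matrix (α × E) (A × B × E) ℂ) * R *
        (∑ a ∈ Finset.univ.filter fun a => (a, b) ∈ S, O z a • transition E z a b :
        Matrix (α × E) (A × B × E) ℂ)ᴴ := by
    rw [measureTrace_eq_sum]
    refine Finset.sum_congr rfl fun z _ => Finset.sum_congr rfl fun b _ => ?_
    have h : measureOp E O z b * (spanProj S : Matrix (A × B × E) (A × B × E) ℂ) =
        ∑ a ∈ Finset.univ.filter fun a => (a, b) ∈ S, O z a • transition E z a b := by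
      rw [measureOp, Matrix.sum_mul, Finset.sum_filter]
      refine Finset.sum_congr rfl fun a _ => ?_
      rw [Matrix.smul_mul, transition_mul_spanProj]
      split_ifs <;> simp
    rw [← h, conjTranspose_mul, spanProj_conjTranspose]
    simp only [Matrix.mul_assoc]
  have h2 : (1 : Matrix α α ℂ) ⊗ₖ restrictE S R = ∑ z, ∑ b,
      ∑ a ∈ Finset.univ.filter fun a => (a, b) ∈ S,
        transition E z a b * R * (transition E z a b)ᴴ := by
    rw [one_kronecker_restrictE]
    refine Finset.sum_congr rfl fun z _ => ?_
    simp only [Finset.sum_filter]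
    rw [Finset.sum_comm, ← Fintype.sum_prod_type
      (f := fun p : A × B => if (p.1, p.2) ∈ S then
        transition E z p.1 p.2 * R * (transition E z p.1 p.2)ᴴ else 0), ← Finset.sum_filter]
    simp
  rw [h1, h2, Finset.smul_sum, ← Finset.sum_sub_distrib]
  refine posSemidef_sum _ fun z _ => ?_
  rw [Finset.smul_sum, ← Finset.sum_sub_distrib]
  refine posSemidef_sum _ fun b _ => ?_
  set s := Finset.univ.filter fun a => (a, b) ∈ S with hs
  have h3 := posSemidef_card_smul_sum_sub hR s fun a => O z a • transition E z a b
  have h4 : (((M * μ : ℝ) : ℂ) • ∑ a ∈ s, transition E z a b * R * (transition E z a b)ᴴ -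
      (s.card : ℂ) • ∑ a ∈ s, (O z a • transition E z a b) * R *
        (O z a • transition E z a b)ᴴ).PosSemidef := by
    rw [Finset.smul_sum, Finset.smul_sum, ← Finset.sum_sub_distrib]
    refine posSemidef_sum _ fun a ha => ?_
    rw [conjTranspose_smul, Matrix.smul_mul, Matrix.smul_mul, Matrix.mul_smul, smul_smul, smul_smul,
      ← sub_smul]
    refine (hR.mul_mul_conjTranspose_same _).smul ?_
    have e : (s.card : ℂ) * (O z a * star (O z a)) = ((s.card * ‖O z a‖ ^ 2 : ℝ) : ℂ) := by
      rw [RCLike.star_def, Complex.mul_conj, Complex.normSq_eq_norm_sq]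
      push_cast
      ring
    rw [mul_assoc, e, ← Complex.ofReal_sub, Complex.zero_le_real, sub_nonneg]
    exact mul_le_mul (hM b) (hμ z (a, b) (Finset.mem_filter.1 ha).2) (by positivity)
      ((Nat.cast_nonneg _).trans (hM b))
  simpa using h4.add h3

/-- If the weight of `R` outside of `S` is small, then the state that results from measuring `A` and
discarding `B` is close to a state of large min-entropy. -/
theorem le_smoothMinEntropy_measureTrace {O : Matrix α A ℂ} (hO : Oᴴ * O = 1)
    {R : Matrix (A × B × E) (A × B × E) ℂ} (hR : IsDensity R) (S : Finset (A × B))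
    {μ M l η s : ℝ} (hμ : ∀ z, ∀ p ∈ S, ‖O z p.1‖ ^ 2 ≤ μ)
    (hM : ∀ b, ((Finset.univ.filter fun a => (a, b) ∈ S).card : ℝ) ≤ M)
    (hl : M * μ ≤ 2 ^ (-l)) (hη0 : 0 < η) (hη1 : η < 1)
    (he : ∑ i, (if (i.1, i.2.1) ∈ S then 0 else (R i i).re) ≤ η ^ 2)
    (hs : 2 * η + 2 * η ^ 2 ≤ s) : (l : EReal) ≤ smoothMinEntropy s (measureTrace O R) := by
  obtain ⟨hRp, hRt⟩ := hR
  set e : ℝ := ∑ i, (if (i.1, i.2.1) ∈ S then 0 else (R i i).re) with hee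
  have he1 : 0 < 1 - e := by nlinarith
  have hRre : ∀ i, ((R i i).re : ℂ) = R i i := fun i =>
    Complex.conj_eq_iff_re.1 (hRp.isHermitian.apply i i)
  have he0 : 0 ≤ e := Finset.sum_nonneg fun i _ => by
    split_ifs
    · exact le_rfl
    · exact (Complex.le_def.1 (hRp.diag_nonneg (i := i))).1
  set P : Matrix (A × B × E) (A × B × E) ℂ := spanProj S with hP
  have hPH : Pᴴ = P := spanProj_conjTranspose S
  set P' := 1 - P with hP'
  have hPH' : P'ᴴ = P' := by rw [hP', conjTranspose_sub, hPH, conjTranspose_one]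
  have hPRP : (P * R * P).PosSemidef := by simpa [hPH] using hRp.mul_mul_conjTranspose_same P
  have hPRP' : (P' * R * P').PosSemidef := by simpa [hPH'] using hRp.mul_mul_conjTranspose_same P'
  have hPd : P' = diagonal fun i => if (i.1, i.2.1) ∈ S then 0 else 1 := by
    rw [hP', hP, spanProj, ← diagonal_one, diagonal_sub]
    congr 1
    ext i
    split_ifs <;> simp
  have ht' : (P' * R * P').trace = (e : ℂ) := by
    rw [hPd, hee, trace, Complex.ofReal_sum]
    refine Finset.sum_congr rfl fun i _ => ?_
    rw [diag_apply, mul_diagonal, diagonal_mul]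
    split_ifs <;> simp [hRre]
  have ht : (P * R * P).trace = ((1 - e : ℝ) : ℂ) := by
    rw [Complex.ofReal_sub, Complex.ofReal_one, ← hRt, ← ht', hPd, hP, spanProj, trace, trace,
      trace, ← Finset.sum_sub_distrib]
    refine Finset.sum_congr rfl fun i _ => ?_
    rw [diag_apply, diag_apply, diag_apply, mul_diagonal, diagonal_mul, mul_diagonal, diagonal_mul]
    split_ifs <;> simp
  set c : ℝ := (1 - e)⁻¹ with hc
  have hc0 : 0 < c := inv_pos.2 he1
  have hce : c * (1 - e) = 1 := inv_mul_cancel₀ he1.ne'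
  set T := (c : ℂ) • (P * R * P) with hT
  have hTp : T.PosSemidef := hPRP.smul (Complex.zero_le_real.2 hc0.le)
  have hTt : T.trace = 1 := by
    rw [hT, trace_smul, ht, smul_eq_mul, ← Complex.ofReal_mul, hce, Complex.ofReal_one]
  -- the trace distance
  have hdist : traceNorm (measureTrace O R - measureTrace O T) ≤ s := by
    rw [← measureTrace_sub]
    -- Here R - T = -c e PRP + (PRP' + P'RP) + P'RP', because c = 1 + c e. The off-diagonal blocks
    -- lie between ±(η PRP + η⁻¹ P'RP'), and the remaining terms of Q dominate the diagonal blocks.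
    -- Using η with e ≤ η² instead of √e also covers e = 0.
    set Q := ((η + c * e : ℝ) : ℂ) • (P * R * P) + ((η⁻¹ + 1 : ℝ) : ℂ) • (P' * R * P') with hQ
    have hr : Real.sqrt η * Real.sqrt η = η := Real.mul_self_sqrt hη0.le
    have hr' : (Real.sqrt η)⁻¹ * (Real.sqrt η)⁻¹ = η⁻¹ := by rw [← mul_inv, hr]
    have hr1 : Real.sqrt η * (Real.sqrt η)⁻¹ = 1 := mul_inv_cancel₀ (Real.sqrt_pos.2 hη0).ne'
    have hRd : R = P * R * P + P * R * P' + P' * R * P + P' * R * P' := by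
      rw [hP']
      simp only [Matrix.sub_mul, Matrix.mul_sub, Matrix.one_mul, Matrix.mul_one]
      abel
    -- Conjugation of R by √η P + x (√η)⁻¹ P', used for x = 1 and x = -1.
    have key : ∀ x : ℝ, x * x = 1 → (((η : ℝ) : ℂ) • (P * R * P) +
        ((η⁻¹ : ℝ) : ℂ) • (P' * R * P') + (x : ℂ) • (P * R * P' + P' * R * P)).PosSemidef := by
      intro x hx
      convert hRp.mul_mul_conjTranspose_same
        ((Real.sqrt η : ℂ) • P + ((x * (Real.sqrt η)⁻¹ : ℝ) : ℂ) • P') using 1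
      rw [conjTranspose_add, conjTranspose_smul, conjTranspose_smul, hPH, hPH']
      simp only [Matrix.add_mul, Matrix.mul_add, Matrix.smul_mul, Matrix.mul_smul, smul_smul,
        RCLike.star_def, Complex.conj_ofReal, smul_add]
      have e1 : x * (Real.sqrt η)⁻¹ * (x * (Real.sqrt η)⁻¹) = η⁻¹ := by
        rw [mul_mul_mul_comm, hx, hr', one_mul]
      have e2 : x * (Real.sqrt η)⁻¹ * Real.sqrt η = x := by
        rw [mul_assoc, mul_comm _ √η, hr1, mul_one]
      have e3 : Real.sqrt η * (x * (Real.sqrt η)⁻¹) = x := by rw [mul_comm, e2]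
      simp only [← Complex.ofReal_mul]
      rw [hr, e1, e2, e3]
      module
    have hce' : (c : ℂ) = 1 + (c * e : ℝ) := by
      rw [← Complex.ofReal_one, ← Complex.ofReal_add]
      congr 1
      linarith
    have hQ1 : (Q - (R - T)).PosSemidef := by
      have h := (key (-1) (by norm_num)).add
        (hPRP.smul (Complex.zero_le_real.2 (by positivity : 0 ≤ 2 * (c * e))))
      convert h using 1
      nth_rewrite 1 [hRd]
      rw [hQ, hT, hce']
      push_cast
      module
    have hQ2 : (Q + (R - T)).PosSemidef := by
      have h := (key 1 (by norm_num)).add (hPRP'.smul (Complex.zero_le_real.2 zero_le_two))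
      convert h using 1
      nth_rewrite 1 [hRd]
      rw [hQ, hT, hce']
      push_cast
      module
    have hQt : (measureTrace O Q).trace.re ≤ s := by
      rw [trace_measureTrace hO, hQ, trace_add, trace_smul, trace_smul, ht, ht', smul_eq_mul,
        smul_eq_mul, ← Complex.ofReal_mul, ← Complex.ofReal_mul, ← Complex.ofReal_add,
        Complex.ofReal_re]
      have h1 : η⁻¹ * e ≤ η := by
        rw [inv_mul_le_iff₀ hη0]
        linarith [sq η]
      have h2 : (η + c * e) * (1 - e) = η * (1 - e) + e := by
        rw [add_mul, mul_right_comm, hce, one_mul]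
      rw [h2]
      nlinarith
    refine (traceNorm_le_of_posSemidef (Q := measureTrace O Q) ?_ ?_ ?_).trans hQt
    · rw [measureTrace_sub]
      exact (measureTrace_posSemidef O hRp).isHermitian.sub
        (measureTrace_posSemidef O hTp).isHermitian
    · rw [← measureTrace_sub]
      exact measureTrace_posSemidef O hQ1
    · rw [← measureTrace_add]
      exact measureTrace_posSemidef O hQ2
  -- the min-entropy
  have hσt : (restrictE S R).trace = ((1 - e : ℝ) : ℂ) := by
    rw [← ht, hP, spanProj, trace, trace]
    simp only [diag_apply, restrictE, mul_diagonal, diagonal_mul]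
    rw [Finset.sum_comm, Fintype.sum_prod_type]
    simp only [Fintype.sum_prod_type]
    rw [← Fintype.sum_prod_type (f := fun p : A × B => ∑ e : E,
      (if p ∈ S then 1 else 0) * R (p.1, p.2, e) (p.1, p.2, e) * if p ∈ S then 1 else 0)]
    rw [← Finset.sum_filter_add_sum_filter_not _ (fun p => p ∈ S)]
    simp +contextual
  refine le_iSup₂_of_le (measureTrace O T)
    ⟨⟨measureTrace_posSemidef O hTp, (trace_measureTrace hO T).trans hTt⟩, hdist⟩ ?_
  -- The state on E that witnesses the min-entropy is the normalized reduction of R restricted to S.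
  refine le_iSup₂_of_le ((c : ℂ) • restrictE S R) l (le_iSup_of_le ⟨⟨?_, ?_⟩, ?_⟩ le_rfl)
  · exact (restrictE_posSemidef S hRp).smul (Complex.zero_le_real.2 hc0.le)
  · rw [trace_smul, hσt, smul_eq_mul, ← Complex.ofReal_mul, hce, Complex.ofReal_one]
  · have h1 := (posSemidef_one_kronecker_restrictE_sub hRp S hμ hM).smul
      (Complex.zero_le_real.2 hc0.le)
    -- Pays for the slack between M μ and 2^(-l).
    have h2 := (PosSemidef.one.kronecker (restrictE_posSemidef S hRp) :
      ((1 : Matrix α α ℂ) ⊗ₖ restrictE S R).PosSemidef).smul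
      (Complex.zero_le_real.2 (mul_nonneg hc0.le (sub_nonneg.2 hl)))
    convert h1.add h2 using 1
    rw [hT, measureTrace_smul, kronecker_smul]
    push_cast
    module

end MeasureTrace

/-! ### Product bases -/

/-- The matrix that expresses a state of a system of qudits in the product basis of `V`. -/
def wordMat (κ : Type*) [Fintype κ] {d : ℕ} (V : QBasis d) : Matrix (Word κ d) (Word κ d) ℂ :=
  fun a w => star (prodKet V a w)

theorem wordMat_mul_conjTranspose_apply {κ : Type*} [Fintype κ] [DecidableEq κ] {d : ℕ}
    (Z X : QBasis d) (z a : Word κ d) :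
    (wordMat κ Z * (wordMat κ X)ᴴ) z a = ∏ k, inner ℂ (Z (z k)) (X (a k)) := by
  simp only [Matrix.mul_apply, conjTranspose_apply, wordMat, star_star, prodKet, star_prod,
    ← Finset.prod_mul_distrib]
  rw [← Fintype.prod_sum (f := fun k j => star (Z (z k) j) * X (a k) j)]
  refine Finset.prod_congr rfl fun k _ => ?_
  rw [PiLp.inner_apply]
  refine Finset.sum_congr rfl fun j _ => ?_
  simp [mul_comm]

theorem wordMat_conjTranspose_mul {κ : Type*} [Fintype κ] [DecidableEq κ] {d : ℕ} (V : QBasis d) :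
    (wordMat κ V)ᴴ * wordMat κ V = 1 := by
  rw [mul_eq_one_comm]
  ext a b
  rw [wordMat_mul_conjTranspose_apply, Matrix.one_apply]
  simp only [OrthonormalBasis.inner_eq_ite]
  split_ifs with h
  · simp [h]
  · obtain ⟨k, hk⟩ := Function.ne_iff.1 h
    exact Finset.prod_eq_zero (Finset.mem_univ k) (if_neg hk)

theorem wordMat_mul_conjTranspose {κ : Type*} [Fintype κ] [DecidableEq κ] {d : ℕ} (V : QBasis d) :
    wordMat κ V * (wordMat κ V)ᴴ = 1 :=
  mul_eq_one_comm.1 (wordMat_conjTranspose_mul V)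

/-- The matrix that expresses an operator on `A ⊗ B ⊗ E` in the product basis of `X` on `A ⊗ B`. -/
def basisMat (κ E : Type*) [Fintype κ] [DecidableEq E] {d : ℕ} (X : QBasis d) :
    Matrix (ABE κ d E) (ABE κ d E) ℂ :=
  wordMat κ X ⊗ₖ (wordMat κ X ⊗ₖ (1 : Matrix E E ℂ))

section BasisMat

variable {κ E : Type*} [Fintype κ] [DecidableEq κ] [Fintype E] [DecidableEq E] {d : ℕ}

theorem basisMat_conjTranspose_mul (X : QBasis d) :
    (basisMat κ E X)ᴴ * basisMat κ E X = 1 := by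
  rw [basisMat, conjTranspose_kronecker, conjTranspose_kronecker, ← mul_kronecker_mul,
    ← mul_kronecker_mul, wordMat_conjTranspose_mul, conjTranspose_one, Matrix.one_mul,
    one_kronecker_one, one_kronecker_one]

theorem trace_basisMat_conj (X : QBasis d) (ρ : Matrix (ABE κ d E) (ABE κ d E) ℂ) :
    (basisMat κ E X * ρ * (basisMat κ E X)ᴴ).trace = ρ.trace := by
  rw [trace_mul_comm, ← Matrix.mul_assoc, basisMat_conjTranspose_mul, Matrix.one_mul]

theorem basisMat_conj_isDensity (X : QBasis d) {ρ : Matrix (ABE κ d E) (ABE κ d E) ℂ}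
    (hρ : IsDensity ρ) : IsDensity (basisMat κ E X * ρ * (basisMat κ E X)ᴴ) :=
  ⟨hρ.1.mul_mul_conjTranspose_same _, (trace_basisMat_conj X ρ).trans hρ.2⟩

end BasisMat

/-- Separates the change of basis on B from that on A, so that the sum over B can be carried out
first in `measureA_traceOutB`. -/
theorem kronecker_conj_apply {A B E : Type*} [Fintype A] [Fintype B] [Fintype E] [DecidableEq E]
    (U : Matrix A A ℂ) (W : Matrix B B ℂ) (ρ : Matrix (A × B × E) (A × B × E) ℂ) (a a' : A)
    (b b' : B) (e e' : E) :
    ((U ⊗ₖ (W ⊗ₖ (1 : Matrix E E ℂ))) * ρ * (U ⊗ₖ (W ⊗ₖ (1 : Matrix E E ℂ)))ᴴ)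
        (a, b, e) (a', b', e') =
      (U * (of fun w w' => ∑ u, ∑ u', W b u * ρ (w, u, e) (w', u', e') * star (W b' u')) * Uᴴ)
        a a' := by
  simp only [Matrix.mul_apply, conjTranspose_apply, kroneckerMap_apply, Fintype.sum_prod_type,
    Matrix.one_apply, of_apply, mul_ite, mul_one, mul_zero, ite_mul, zero_mul,
    Finset.sum_ite_eq, Finset.mem_univ, if_true, apply_ite star, star_zero, star_mul,
    Finset.sum_mul, Finset.mul_sum]
  refine Finset.sum_congr rfl fun w' _ => ?_
  rw [Finset.sum_comm]
  refine Finset.sum_congr rfl fun w _ => ?_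
  rw [Finset.sum_comm]
  refine Finset.sum_congr rfl fun u _ => Finset.sum_congr rfl fun u' _ => ?_
  ring

/-- The partial trace over B may be taken in the X basis, and in X coordinates on A the Z
measurement has amplitudes ⟨z|x_a⟩. All further estimates can therefore be made in the X product
basis. -/
theorem measureA_traceOutB {κ E : Type*} [Fintype κ] [DecidableEq κ] [Fintype E] [DecidableEq E]
    {d : ℕ} (Z X : QBasis d) (ρ : Matrix (ABE κ d E) (ABE κ d E) ℂ) :
    measureA Z (traceOutB ρ) = measureTrace (wordMat κ Z * (wordMat κ X)ᴴ)
      (basisMat κ E X * ρ * (basisMat κ E X)ᴴ) := by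
  ext ⟨z, e⟩ ⟨z', e'⟩
  rw [measureA, measureTrace]
  split_ifs with h
  swap
  · rfl
  set UX := wordMat κ X
  set UZ := wordMat κ Z
  set N : Word κ d → Matrix (Word κ d) (Word κ d) ℂ := fun b =>
    of fun w w' => ∑ u, ∑ u', UX b u * ρ (w, u, e) (w', u', e') * star (UX b u') with hN
  have hNs : ∑ b, N b = of fun w w' => ∑ u, ρ (w, u, e) (w', u, e') := by
    ext w w'
    rw [Matrix.sum_apply]
    simp only [hN, of_apply]
    rw [Finset.sum_comm]
    refine Finset.sum_congr rfl fun u _ => ?_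
    rw [Finset.sum_comm]
    have h1 : ∀ u', ∑ b, UX b u * ρ (w, u, e) (w', u', e') * star (UX b u') =
        (if u' = u then 1 else 0) * ρ (w, u, e) (w', u', e') := by
      intro u'
      have := congrFun (congrFun (wordMat_conjTranspose_mul (κ := κ) X) u') u
      rw [Matrix.mul_apply, Matrix.one_apply] at this
      rw [← this, Finset.sum_mul]
      refine Finset.sum_congr rfl fun b _ => ?_
      rw [conjTranspose_apply]
      ring
    simp only [h1, ite_mul, one_mul, zero_mul, Finset.sum_ite_eq', Finset.mem_univ, if_true]
  have hR : ∑ b, ∑ a, ∑ a', (UZ * UXᴴ) z a * star ((UZ * UXᴴ) z a') *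
      (basisMat κ E X * ρ * (basisMat κ E X)ᴴ) (a, b, e) (a', b, e') =
        (UZ * (∑ b, N b) * UZᴴ) z z := by
    rw [Matrix.mul_sum, Matrix.sum_mul, Matrix.sum_apply]
    refine Finset.sum_congr rfl fun b _ => ?_
    have h2 : UZ * N b * UZᴴ = (UZ * UXᴴ) * (UX * N b * UXᴴ) * (UZ * UXᴴ)ᴴ := by
      have h3 : UXᴴ * UX = 1 := wordMat_conjTranspose_mul X
      rw [conjTranspose_mul, conjTranspose_conjTranspose]
      calc UZ * N b * UZᴴ = UZ * 1 * N b * 1 * UZᴴ := by simp only [Matrix.mul_one]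
        _ = _ := by rw [← h3]; simp only [Matrix.mul_assoc]
    rw [h2]
    simp only [Matrix.mul_apply (M := UZ * UXᴴ * (UX * N b * UXᴴ)),
      Matrix.mul_apply (M := UZ * UXᴴ) (N := UX * N b * UXᴴ), Finset.sum_mul,
      conjTranspose_apply (M := UZ * UXᴴ)]
    rw [Finset.sum_comm]
    refine Finset.sum_congr rfl fun a' _ => Finset.sum_congr rfl fun a _ => ?_
    rw [basisMat, kronecker_conj_apply]
    ring
  change _ = ∑ b, ∑ a, ∑ a', (UZ * UXᴴ) z a * star ((UZ * UXᴴ) z a') *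
      (basisMat κ E X * ρ * (basisMat κ E X)ᴴ) (a, b, e) (a', b, e')
  rw [hR, hNs]
  simp only [Matrix.mul_apply, Finset.sum_mul]
  rw [Finset.sum_comm]
  simp [UZ, wordMat, traceOutB]

/-! ### Overlaps -/

theorem overlap_le_maxOverlap {d : ℕ} (Z X : QBasis d) (a b : Fin d) :
    overlap Z X a b ≤ maxOverlap Z X :=
  le_ciSup (f := fun p : Fin d × Fin d => overlap Z X p.1 p.2) (Set.finite_range _).bddAbove (a, b)

theorem overlap_le_maxOverlapExcept {d : ℕ} (Z X : QBasis d) {a b a' b' : Fin d}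
    (h : (a, b) ≠ (a', b')) : overlap Z X a b ≤ maxOverlapExcept Z X a' b' :=
  le_ciSup (f := fun p : {p : Fin d × Fin d // p ≠ (a', b')} => overlap Z X p.1.1 p.1.2)
    (Set.finite_range _).bddAbove ⟨(a, b), h⟩

/-- A unit vector x_b with b ≠ b' cannot be orthogonal to every z_a. Positivity is what makes the
logarithm defining γ invertible by a power of 2. -/
theorem maxOverlapExcept_pos {d : ℕ} (hd : 2 ≤ d) (Z X : QBasis d) (a' b' : Fin d) :
    0 < maxOverlapExcept Z X a' b' := by
  have : Nontrivial (Fin d) := Fin.nontrivial_iff_two_le.2 hd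
  obtain ⟨b, hb⟩ := exists_ne b'
  obtain ⟨a, ha⟩ : ∃ a, inner ℂ (Z a) (X b) ≠ 0 := by
    by_contra! h
    have h1 := Z.sum_sq_norm_inner_right (X b)
    simp [h] at h1
  exact (pow_pos (norm_pos_iff.2 ha) 2).trans_le
    (overlap_le_maxOverlapExcept Z X fun h => hb (congrArg Prod.snd h))

theorem maxOverlapExcept_le_maxOverlap {d : ℕ} (hd : 2 ≤ d) (Z X : QBasis d) (a' b' : Fin d) :
    maxOverlapExcept Z X a' b' ≤ maxOverlap Z X := by
  have : Nontrivial (Fin d) := Fin.nontrivial_iff_two_le.2 hd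
  obtain ⟨b, hb⟩ := exists_ne b'
  have : Nonempty {p : Fin d × Fin d // p ≠ (a', b')} :=
    ⟨⟨(a', b), fun h => hb (congrArg Prod.snd h)⟩⟩
  exact ciSup_le fun p => overlap_le_maxOverlap Z X _ _

/-- The overlap of two product vectors, the second of which has few letters `b'`. -/
theorem norm_sq_overlap_word_le {κ : Type*} [Fintype κ] [DecidableEq κ] [Nonempty κ] {d : ℕ}
    (hd : 2 ≤ d) (Z X : QBasis d) (a' b' : Fin d) {x : ℝ} {z a : Word κ d}
    (ha : relCount b' a ≤ x) :
    ‖(wordMat κ Z * (wordMat κ X)ᴴ) z a‖ ^ 2 ≤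
      (2 : ℝ) ^ (-(Fintype.card κ * x * -Real.logb 2 (maxOverlap Z X) +
        Fintype.card κ * (1 - x) * -Real.logb 2 (maxOverlapExcept Z X a' b'))) := by
  have hp := maxOverlapExcept_pos hd Z X a' b'
  have hle := maxOverlapExcept_le_maxOverlap hd Z X a' b'
  have hp' := hp.trans_le hle
  have hlog := Real.logb_le_logb_of_le one_lt_two hp hle
  set p := maxOverlapExcept Z X a' b'
  set q := maxOverlap Z X
  rw [wordMat_mul_conjTranspose_apply, norm_prod, ← Finset.prod_pow]
  have h1 : ∏ k, ‖(inner ℂ (Z (z k)) (X (a k)) : ℂ)‖ ^ 2 ≤ ∏ k, if a k = b' then q else p := by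
    refine Finset.prod_le_prod (fun k _ => by positivity) fun k _ => ?_
    split_ifs with h
    · exact overlap_le_maxOverlap Z X _ _
    · exact overlap_le_maxOverlapExcept Z X fun h' => h (congrArg Prod.snd h')
  refine h1.trans ?_
  have hN : (0 : ℝ) < Fintype.card κ := by exact_mod_cast Fintype.card_pos
  rw [relCount, div_le_iff₀ hN] at ha
  rw [Finset.prod_ite, Finset.prod_const, Finset.prod_const]
  have hc := Finset.card_filter_add_card_filter_not
    (s := (Finset.univ : Finset κ)) (fun k => a k = b')
  rw [Finset.card_univ] at hc
  set g := (Finset.univ.filter fun k => a k = b').card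
  set g' := (Finset.univ.filter fun k => ¬ a k = b').card
  rw [← Real.rpow_natCast, ← Real.rpow_natCast]
  have e : ∀ y : ℝ, 0 < y → ∀ w : ℝ, y ^ w = (2 : ℝ) ^ (Real.logb 2 y * w) := by
    intro y hy w
    rw [Real.rpow_mul zero_le_two, Real.rpow_logb zero_lt_two one_lt_two.ne' hy]
  rw [e _ hp', e _ hp, ← Real.rpow_add zero_lt_two]
  refine Real.rpow_le_rpow_of_exponent_le one_le_two ?_
  rw [← hc] at ha ⊢
  push_cast at ha ⊢
  -- The excluded maximum is at most the full one, so the bound grows with the number of letters b',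
  -- which may be raised to N x.
  nlinarith [mul_nonneg (sub_nonneg.2 hlog) (sub_nonneg.2 ha)]

/-! ### The sampling experiment -/

section Experiment

variable {n m d : ℕ} {E : Type*} [Fintype E] [DecidableEq E]

/-- The word with given restrictions to the sampled and to the remaining positions. -/
def glue (t : SampleSet n m) (q : Word (Sampled t) d) (a : Word (Rest t) d) :
    Word (Fin (n + m)) d :=
  (Equiv.piEquivPiSubtypeProd (fun i => i ∈ t.1) fun _ => Fin d).symm (q, a)

theorem glue_sampled (t : SampleSet n m) (q : Word (Sampled t) d) (a : Word (Rest t) d) :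
    (fun k : Sampled t => glue t q a k.1) = q := by
  ext k
  simp [glue, Equiv.piEquivPiSubtypeProd, k.2]

theorem glue_rest (t : SampleSet n m) (q : Word (Sampled t) d) (a : Word (Rest t) d) :
    (fun k : Rest t => glue t q a k.1) = a := by
  ext k
  simp [glue, Equiv.piEquivPiSubtypeProd, k.2]

theorem prodKet_glue (X : QBasis d) (t : SampleSet n m) (q : Word (Sampled t) d)
    (a : Word (Rest t) d) (w : Word (Fin (n + m)) d) :
    prodKet X (glue t q a) w =
      prodKet X a (fun k => w k.1) * prodKet X q (fun k => w k.1) := by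
  rw [prodKet, ← Fintype.prod_subtype_mul_prod_subtype (fun i => i ∈ t.1), mul_comm]
  congr 1
  · refine Finset.prod_congr rfl fun k _ => ?_
    rw [← congrFun (glue_rest t q a) k]
  · refine Finset.prod_congr (Finset.ext fun _ => by simp) fun k _ => ?_
    rw [← congrFun (glue_sampled t q a) k]

theorem sum_glue {M : Type*} [AddCommMonoid M] (t : SampleSet n m)
    (f : Word (Fin (n + m)) d → M) : ∑ q, ∑ a, f (glue t q a) = ∑ w, f w := by
  rw [← Fintype.sum_prod_type' (f := fun q a => f (glue t q a))]
  exact Equiv.sum_comp (Equiv.piEquivPiSubtypeProd (fun i => i ∈ t.1) fun _ => Fin d).symm f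

omit [DecidableEq E] in
theorem sum_glue_ABE {M : Type*} [AddCommMonoid M] (t : SampleSet n m)
    (f : ABE (Fin (n + m)) d E → M) :
    ∑ qA, ∑ qB, ∑ i : ABE (Rest t) d E, f (glue t qA i.1, glue t qB i.2.1, i.2.2) =
      ∑ i, f i := by
  simp only [Fintype.sum_prod_type]
  rw [← sum_glue t]
  refine Finset.sum_congr rfl fun qA _ => ?_
  rw [Finset.sum_comm]
  refine Finset.sum_congr rfl fun a _ => ?_
  rw [← sum_glue t]

/-- Product vectors factor over sampled and remaining positions, so an outcome just fixes the
sampled letters of a full X-basis vector. -/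
theorem basisMat_mul_outcomeOp_apply (X : QBasis d) (t : SampleSet n m)
    (qA qB : Word (Sampled t) d) (i : ABE (Rest t) d E)
    (j : SampleSet n m × ABE (Fin (n + m)) d E) :
    (basisMat (Rest t) E X * outcomeOp (E := E) X t qA qB) i j =
      if j.1 = t then basisMat (Fin (n + m)) E X (glue t qA i.1, glue t qB i.2.1, i.2.2) j.2
      else 0 := by
  rw [Matrix.mul_apply]
  by_cases h : j.1 = t
  · rw [if_pos h, Finset.sum_eq_single_of_mem
      ((fun k : Rest t => j.2.1 k.1), (fun k : Rest t => j.2.2.1 k.1), j.2.2.2) (Finset.mem_univ _)]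
    · rw [outcomeOp, if_pos ⟨h, rfl, rfl, rfl⟩]
      simp only [basisMat, kroneckerMap_apply, wordMat, prodKet_glue, star_mul]
      ring
    · intro k _ hk
      rw [outcomeOp, if_neg, mul_zero]
      rintro ⟨-, h1, h2, h3⟩
      exact hk (Prod.ext h1.symm (Prod.ext h2.symm h3.symm))
  · rw [if_neg h]
    refine Finset.sum_eq_zero fun k _ => ?_
    rw [outcomeOp, if_neg fun h' => h h'.1, mul_zero]

/-- In the product basis, the unnormalized state after the measurement is a block of the input
state. -/
theorem basisMat_conj_unnormalizedState (X : QBasis d)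
    (ρ : Matrix (ABE (Fin (n + m)) d E) (ABE (Fin (n + m)) d E) ℂ) (t : SampleSet n m)
    (qA qB : Word (Sampled t) d) :
    basisMat (Rest t) E X * unnormalizedState X (uniformInput ρ) t qA qB *
        (basisMat (Rest t) E X)ᴴ =
      (1 / ((n + m).choose m : ℂ)) •
        (basisMat (Fin (n + m)) E X * ρ * (basisMat (Fin (n + m)) E X)ᴴ).submatrix
          (fun i => (glue t qA i.1, glue t qB i.2.1, i.2.2))
          (fun i => (glue t qA i.1, glue t qB i.2.1, i.2.2)) := by
  have h : basisMat (Rest t) E X * unnormalizedState X (uniformInput ρ) t qA qB *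
      (basisMat (Rest t) E X)ᴴ =
      (basisMat (Rest t) E X * outcomeOp (E := E) X t qA qB) * uniformInput ρ *
        (basisMat (Rest t) E X * outcomeOp (E := E) X t qA qB)ᴴ := by
    rw [unnormalizedState, conjTranspose_mul]
    simp only [Matrix.mul_assoc]
  rw [h]
  ext i j
  have hG := basisMat_mul_outcomeOp_apply (E := E) X t qA qB
  have hU : ∀ k l, uniformInput (n := n) (m := m) ρ k l =
      if k.1 = l.1 then 1 / ((n + m).choose m : ℂ) * ρ k.2 l.2 else 0 := by
    intro k l
    rw [uniformInput, kroneckerMap_apply, diagonal_apply, ite_mul, zero_mul]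
  generalize basisMat (Rest t) E X * outcomeOp (E := E) X t qA qB = G at hG ⊢
  generalize uniformInput (n := n) (m := m) ρ = U at hU ⊢
  simp only [Matrix.smul_apply, submatrix_apply, smul_eq_mul, Matrix.mul_apply,
    conjTranspose_apply, hG, hU, Fintype.sum_prod_type (α₁ := SampleSet n m)]
  rw [Finset.sum_eq_single_of_mem t (Finset.mem_univ _)]
  · rw [Finset.mul_sum]
    refine Finset.sum_congr rfl fun x _ => ?_
    rw [Finset.sum_eq_single_of_mem t (Finset.mem_univ _)]
    · simp only [if_true]
      rw [← mul_assoc, Finset.mul_sum]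
      congr 1
      refine Finset.sum_congr rfl fun y _ => ?_
      ring
    · intro t' _ ht'
      simp [ht']
  · intro t' _ ht'
    simp [ht']

theorem unnormalizedState_posSemidef (X : QBasis d)
    {ρ : Matrix (ABE (Fin (n + m)) d E) (ABE (Fin (n + m)) d E) ℂ} (hρ : ρ.PosSemidef)
    (t : SampleSet n m) (qA qB : Word (Sampled t) d) :
    (unnormalizedState X (uniformInput ρ) t qA qB).PosSemidef := by
  refine PosSemidef.mul_mul_conjTranspose_same (PosSemidef.kronecker (PosSemidef.diagonal ?_) hρ) _
  intro _
  simp only [Pi.zero_apply]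
  rw [show (1 / ((n + m).choose m : ℂ)) = ((1 / ((n + m).choose m : ℝ) : ℝ) : ℂ) by push_cast; rfl]
  exact Complex.zero_le_real.2 (by positivity)

/-- The distribution of the outcome if all qudits of `A` and `B`, and `E`, are measured. -/
def weight (X : QBasis d) (ρ : Matrix (ABE (Fin (n + m)) d E) (ABE (Fin (n + m)) d E) ℂ)
    (i : ABE (Fin (n + m)) d E) : ℝ :=
  ((basisMat (Fin (n + m)) E X * ρ * (basisMat (Fin (n + m)) E X)ᴴ) i i).re

theorem weight_nonneg (X : QBasis d)
    {ρ : Matrix (ABE (Fin (n + m)) d E) (ABE (Fin (n + m)) d E) ℂ} (hρ : IsDensity ρ)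
    (i : ABE (Fin (n + m)) d E) : 0 ≤ weight X ρ i :=
  (Complex.le_def.1 ((basisMat_conj_isDensity X hρ).1.diag_nonneg (i := i))).1

theorem sum_weight (X : QBasis d)
    {ρ : Matrix (ABE (Fin (n + m)) d E) (ABE (Fin (n + m)) d E) ℂ} (hρ : IsDensity ρ) :
    ∑ i, weight X ρ i = 1 := by
  have h := congrArg Complex.re (basisMat_conj_isDensity X hρ).2
  rw [trace, Complex.re_sum] at h
  exact h

theorem re_basisMat_conj_unnormalizedState_apply (X : QBasis d)
    (ρ : Matrix (ABE (Fin (n + m)) d E) (ABE (Fin (n + m)) d E) ℂ) (t : SampleSet n m)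
    (qA qB : Word (Sampled t) d) (i : ABE (Rest t) d E) :
    ((basisMat (Rest t) E X * unnormalizedState X (uniformInput ρ) t qA qB *
        (basisMat (Rest t) E X)ᴴ) i i).re =
      weight X ρ (glue t qA i.1, glue t qB i.2.1, i.2.2) / (n + m).choose m := by
  rw [basisMat_conj_unnormalizedState, Matrix.smul_apply, submatrix_apply, smul_eq_mul, weight,
    show (1 / ((n + m).choose m : ℂ)) = ((1 / ((n + m).choose m : ℝ) : ℝ) : ℂ) by push_cast; rfl,
    Complex.re_ofReal_mul]
  ring

/-- The outcome law is that of a uniform t drawn independently of a pair of words distributed by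
`weight`; quantum sampling is thereby reduced to classical sampling. -/
theorem outcomeProb_eq (X : QBasis d)
    (ρ : Matrix (ABE (Fin (n + m)) d E) (ABE (Fin (n + m)) d E) ℂ) (t : SampleSet n m)
    (qA qB : Word (Sampled t) d) :
    outcomeProb X (uniformInput ρ) t qA qB = ∑ i : ABE (Rest t) d E,
      weight X ρ (glue t qA i.1, glue t qB i.2.1, i.2.2) / (n + m).choose m := by
  rw [outcomeProb, ← trace_basisMat_conj X, trace, Complex.re_sum]
  exact Finset.sum_congr rfl fun i _ => re_basisMat_conj_unnormalizedState_apply X ρ t qA qB i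

theorem card_sampleSet : Fintype.card (SampleSet n m) = (n + m).choose m := by
  have : Fintype.card (SampleSet n m) =
      ((Finset.univ : Finset (Fin (n + m))).powersetCard m).card :=
    Fintype.card_of_subtype _ fun t => by simp [Finset.mem_powersetCard]
  rw [this, Finset.card_powersetCard, Finset.card_univ, Fintype.card_fin]

theorem sum_outcomeProb (X : QBasis d)
    {ρ : Matrix (ABE (Fin (n + m)) d E) (ABE (Fin (n + m)) d E) ℂ} (hρ : IsDensity ρ) :
    ∑ t : SampleSet n m, ∑ qA, ∑ qB, outcomeProb X (uniformInput ρ) t qA qB = 1 := by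
  have hT : ((n + m).choose m : ℝ) ≠ 0 := by
    exact_mod_cast (Nat.choose_pos (Nat.le_add_left m n)).ne'
  have h : ∀ t : SampleSet n m, ∑ qA, ∑ qB, outcomeProb X (uniformInput ρ) t qA qB =
      1 / (n + m).choose m := by
    intro t
    simp only [outcomeProb_eq]
    rw [sum_glue_ABE t fun i => weight X ρ i / (n + m).choose m, ← Finset.sum_div, sum_weight X hρ]
  rw [Finset.sum_congr rfl fun t _ => h t, Finset.sum_const, Finset.card_univ, card_sampleSet,
    nsmul_eq_mul, mul_one_div_cancel hT]

theorem outcomeProb_nonneg (X : QBasis d)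
    {ρ : Matrix (ABE (Fin (n + m)) d E) (ABE (Fin (n + m)) d E) ℂ} (hρ : IsDensity ρ)
    (t : SampleSet n m) (qA qB : Word (Sampled t) d) :
    0 ≤ outcomeProb X (uniformInput ρ) t qA qB := by
  rw [outcomeProb_eq]
  exact Finset.sum_nonneg fun i _ => div_nonneg (weight_nonneg X hρ _) (by positivity)

theorem experimentProb_le_one (X : QBasis d)
    {ρ : Matrix (ABE (Fin (n + m)) d E) (ABE (Fin (n + m)) d E) ℂ} (hρ : IsDensity ρ)
    (event : (t : SampleSet n m) → Word (Sampled t) d → Word (Sampled t) d → Prop) :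
    experimentProb X (uniformInput ρ) event ≤ 1 := by
  rw [← sum_outcomeProb (n := n) (m := m) X hρ, experimentProb]
  refine Finset.sum_le_sum fun t _ => Finset.sum_le_sum fun qA _ => Finset.sum_le_sum fun qB _ => ?_
  split_ifs
  · exact le_rfl
  · exact outcomeProb_nonneg X hρ t qA qB

/-- Markov's inequality for the weight of the post-measurement state outside of a set of words. -/
theorem experimentProb_le_of_sampling (X : QBasis d)
    {ρ : Matrix (ABE (Fin (n + m)) d E) (ABE (Fin (n + m)) d E) ℂ} (hρ : IsDensity ρ)
    (event : (t : SampleSet n m) → Word (Sampled t) d → Word (Sampled t) d → Prop)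
    (S : (t : SampleSet n m) → Word (Sampled t) d → Word (Sampled t) d →
      Finset (Word (Rest t) d × Word (Rest t) d)) {θ p : ℝ} (hθ : 0 < θ)
    (hS : ∀ w u : Word (Fin (n + m)) d,
      ((Finset.univ.filter fun t : SampleSet n m =>
        ((fun k => w k.1, fun k => u k.1) : Word (Rest t) d × Word (Rest t) d) ∉
          S t (fun k => w k.1) fun k => u k.1).card : ℝ) ≤ (n + m).choose m * p)
    (hevent : ∀ t qA qB, IsDensity (postState X (uniformInput ρ) t qA qB) →
      ∑ i : ABE (Rest t) d E, (if (i.1, i.2.1) ∈ S t qA qB then 0 else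
        ((basisMat (Rest t) E X * postState X (uniformInput ρ) t qA qB *
          (basisMat (Rest t) E X)ᴴ) i i).re) ≤ θ → ¬ event t qA qB) :
    experimentProb X (uniformInput ρ) event ≤ p / θ := by
  classical
  have hT : (0 : ℝ) < (n + m).choose m := by
    exact_mod_cast Nat.choose_pos (Nat.le_add_left m n)
  have h1 : ∀ t qA qB, (if event t qA qB then outcomeProb X (uniformInput ρ) t qA qB else 0) ≤
      (∑ i : ABE (Rest t) d E, if (i.1, i.2.1) ∈ S t qA qB then 0 else
        weight X ρ (glue t qA i.1, glue t qB i.2.1, i.2.2) / (n + m).choose m) / θ := by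
    intro t qA qB
    have hb : 0 ≤ ∑ i : ABE (Rest t) d E, if (i.1, i.2.1) ∈ S t qA qB then 0 else
        weight X ρ (glue t qA i.1, glue t qB i.2.1, i.2.2) / (n + m).choose m :=
      Finset.sum_nonneg fun i _ => by
        split_ifs
        · exact le_rfl
        · exact div_nonneg (weight_nonneg X hρ _) hT.le
    split_ifs with hev
    swap
    · exact div_nonneg hb hθ.le
    -- With probability 0, `postState` is the zero matrix rather than a density operator, but such
    -- outcomes contribute nothing.
    rcases (outcomeProb_nonneg X hρ t qA qB).eq_or_lt with h0 | h0
    · rw [← h0]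
      exact div_nonneg hb hθ.le
    rw [le_div_iff₀ hθ]
    -- If the joint weight outside S were below θ times the outcome probability, the conditional
    -- weight would be at most θ and the event would fail.
    by_contra! hlt
    refine hevent t qA qB ⟨?_, ?_⟩ ?_ hev
    · exact (unnormalizedState_posSemidef X hρ.1 t qA qB).smul
        (Complex.zero_le_real.2 (inv_nonneg.2 h0.le))
    · have htr : (unnormalizedState X (uniformInput ρ) t qA qB).trace =
          (outcomeProb X (uniformInput ρ) t qA qB : ℂ) := by
        have := Complex.le_def.1 (unnormalizedState_posSemidef X hρ.1 t qA qB).trace_nonneg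
        exact Complex.ext rfl (by simpa using this.2.symm)
      rw [postState, trace_smul, htr, smul_eq_mul, ← Complex.ofReal_mul, inv_mul_cancel₀ h0.ne',
        Complex.ofReal_one]
    · have hpost : ∀ i, ((basisMat (Rest t) E X * postState X (uniformInput ρ) t qA qB *
          (basisMat (Rest t) E X)ᴴ) i i).re = (outcomeProb X (uniformInput ρ) t qA qB)⁻¹ *
            (weight X ρ (glue t qA i.1, glue t qB i.2.1, i.2.2) / (n + m).choose m) := by
        intro i
        rw [postState, Matrix.mul_smul, Matrix.smul_mul, Matrix.smul_apply, smul_eq_mul,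
          Complex.re_ofReal_mul, re_basisMat_conj_unnormalizedState_apply]
      simp only [hpost]
      rw [← mul_le_mul_iff_right₀ h0, Finset.mul_sum]
      refine le_trans (le_of_eq ?_) hlt.le
      refine Finset.sum_congr rfl fun i _ => ?_
      split_ifs
      · simp
      · rw [mul_inv_cancel_left₀ h0.ne']
  calc experimentProb X (uniformInput ρ) event
      ≤ ∑ t : SampleSet n m, ∑ qA, ∑ qB, (∑ i : ABE (Rest t) d E,
          if (i.1, i.2.1) ∈ S t qA qB then 0 else
            weight X ρ (glue t qA i.1, glue t qB i.2.1, i.2.2) / (n + m).choose m) / θ := by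
        rw [experimentProb]
        refine Finset.sum_le_sum fun t _ => Finset.sum_le_sum fun qA _ =>
          Finset.sum_le_sum fun qB _ => ?_
        convert h1 t qA qB
    _ = (∑ t : SampleSet n m, ∑ i : ABE (Fin (n + m)) d E,
          if ((fun k => i.1 k.1, fun k => i.2.1 k.1) : Word (Rest t) d × Word (Rest t) d) ∈
            S t (fun k => i.1 k.1) (fun k => i.2.1 k.1) then 0 else
              weight X ρ i / (n + m).choose m) / θ := by
        rw [Finset.sum_div]
        refine Finset.sum_congr rfl fun t _ => ?_
        rw [← sum_glue_ABE t]
        simp only [glue_sampled, glue_rest, Finset.sum_div]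
    _ = (∑ i : ABE (Fin (n + m)) d E, weight X ρ i / (n + m).choose m *
          (Finset.univ.filter fun t : SampleSet n m =>
            ((fun k => i.1 k.1, fun k => i.2.1 k.1) : Word (Rest t) d × Word (Rest t) d) ∉
              S t (fun k => i.1 k.1) fun k => i.2.1 k.1).card) / θ := by
        -- Exchanging the sums fixes the pair of words and lets t vary, which is the setting of
        -- `hS`.
        rw [Finset.sum_comm]
        congr 1
        refine Finset.sum_congr rfl fun i _ => ?_
        simp only [Finset.card_filter, Nat.cast_sum, Finset.mul_sum]
        refine Finset.sum_congr rfl fun t _ => ?_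
        split_ifs <;> simp_all
    _ ≤ (∑ i : ABE (Fin (n + m)) d E, weight X ρ i * p) / θ := by
        refine div_le_div_of_nonneg_right (Finset.sum_le_sum fun i _ => ?_) hθ.le
        refine (mul_le_mul_of_nonneg_left (hS i.1 i.2.1)
          (div_nonneg (weight_nonneg X hρ i) hT.le)).trans_eq ?_
        field_simp
    _ = p / θ := by rw [← Finset.sum_mul, sum_weight X hρ, one_mul]

end Experiment

/-! ### Typical pairs of words and the resulting entropy bound -/

theorem card_filter_rest {n m : ℕ} (t : SampleSet n m) (p : Fin (n + m) → Prop)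
    [DecidablePred p] : ((Finset.univ.filter fun k : Rest t => p k.1).card : ℝ) =
      ∑ i ∈ t.1ᶜ, if p i then 1 else 0 := by
  rw [Finset.card_filter, Nat.cast_sum, Finset.sum_subtype (F := inferInstance) t.1ᶜ
    (p := fun i => i ∉ t.1) (by simp)]
  simp

theorem card_filter_sampled {n m : ℕ} (t : SampleSet n m) (p : Fin (n + m) → Prop)
    [DecidablePred p] : ((Finset.univ.filter fun k : Sampled t => p k.1).card : ℝ) =
      ∑ i ∈ t.1, if p i then 1 else 0 := by
  rw [Finset.card_filter, Nat.cast_sum, Finset.sum_subtype (F := inferInstance) t.1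
    (p := fun i => i ∈ t.1) (by simp)]
  simp

theorem card_sampled {n m : ℕ} (t : SampleSet n m) : Fintype.card (Sampled t) = m := by
  simp [t.2]

theorem card_rest {n m : ℕ} (t : SampleSet n m) : Fintype.card (Rest t) = n := by
  simp [Fintype.card_subtype_compl, t.2]

/-- The pairs of words on the remaining positions that are consistent, up to `δ`, with the words
that were observed on the sampled positions. -/
def typicalSet {n m d : ℕ} (b : Fin d) (δ : ℝ) (t : SampleSet n m) (qA qB : Word (Sampled t) d) :
    Finset (Word (Rest t) d × Word (Rest t) d) :=
  Finset.univ.filter fun p => relHammingDist p.1 p.2 ≤ relHammingDist qA qB + δ ∧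
    relCount b p.1 ≤ relCount b qA + δ

/-- Union bound over two populations of zeros and ones: the positions where w and u differ, and the
positions where w has the letter b. -/
theorem card_not_mem_typicalSet_le {n m d : ℕ} (hm : 1 ≤ m) (hmn : m ≤ n) (b : Fin d) {L δ : ℝ}
    (hδ0 : 0 ≤ δ) (hδ : ((m : ℝ) + n + 2) * L / ((m : ℝ) * ((m : ℝ) + n)) ≤ δ ^ 2)
    (w u : Word (Fin (n + m)) d) :
    ((Finset.univ.filter fun t : SampleSet n m =>
      ((fun k => w k.1, fun k => u k.1) : Word (Rest t) d × Word (Rest t) d) ∉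
        typicalSet b δ t (fun k => w k.1) fun k => u k.1).card : ℝ) ≤
      (n + m).choose m * (2 * Real.exp (-L)) := by
  classical
  set v₁ : Fin (n + m) → ℝ := fun i => if w i ≠ u i then 1 else 0 with hv₁
  set v₂ : Fin (n + m) → ℝ := fun i => if w i = b then 1 else 0 with hv₂
  have h₁ := card_filter_sampling_le hm hmn v₁
    (fun i => by simp only [hv₁]; split_ifs <;> norm_num) hδ0 hδ
  have h₂ := card_filter_sampling_le hm hmn v₂
    (fun i => by simp only [hv₂]; split_ifs <;> norm_num) hδ0 hδ
  set F₁ := (Finset.univ.powersetCard m).filter fun t : Finset (Fin (n + m)) =>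
    (∑ i ∈ t, v₁ i) / m + δ < (∑ i ∈ tᶜ, v₁ i) / n
  set F₂ := (Finset.univ.powersetCard m).filter fun t : Finset (Fin (n + m)) =>
    (∑ i ∈ t, v₂ i) / m + δ < (∑ i ∈ tᶜ, v₂ i) / n
  have hle : (Finset.univ.filter fun t : SampleSet n m =>
      ((fun k => w k.1, fun k => u k.1) : Word (Rest t) d × Word (Rest t) d) ∉
        typicalSet b δ t (fun k => w k.1) fun k => u k.1).card ≤ (F₁ ∪ F₂).card := by
    refine Finset.card_le_card_of_injOn (fun t => t.1) ?_ Subtype.val_injective.injOn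
    intro t ht
    have ht2 := (Finset.mem_filter.1 ht).2
    rw [typicalSet, Finset.mem_filter] at ht2
    simp only [Finset.mem_univ, true_and, not_and_or, not_le, relHammingDist, relCount,
      card_sampled, card_rest] at ht2
    rw [card_filter_rest t fun i => w i ≠ u i, card_filter_rest t fun i => w i = b,
      card_filter_sampled t fun i => w i ≠ u i, card_filter_sampled t fun i => w i = b] at ht2
    have hmem : t.1 ∈ Finset.univ.powersetCard m := Finset.mem_powersetCard.2 ⟨by simp, t.2⟩
    rw [Finset.mem_coe, Finset.mem_union, Finset.mem_filter, Finset.mem_filter]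
    exact ht2.imp (fun h => ⟨hmem, h⟩) fun h => ⟨hmem, h⟩
  calc _ ≤ ((F₁ ∪ F₂).card : ℝ) := by exact_mod_cast hle
    _ ≤ F₁.card + F₂.card := by exact_mod_cast Finset.card_union_le _ _
    _ ≤ _ := by linarith

/-- The post-measurement state has a large smooth min-entropy if, in the product basis of `X`, it is
almost supported on the typical set. -/
theorem le_smoothMinEntropyAZ {n m d : ℕ} (hd : 2 ≤ d) (hn : 1 ≤ n) {E : Type*} [Fintype E]
    [DecidableEq E] (Z X : QBasis d) (a' b' : Fin d) {δ η s : ℝ} (hδ0 : 0 ≤ δ) (hη0 : 0 < η)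
    (hη1 : η < 1) (hs : 2 * η + 2 * η ^ 2 ≤ s) (t : SampleSet n m) (qA qB : Word (Sampled t) d)
    {σ : Matrix (ABE (Rest t) d E) (ABE (Rest t) d E) ℂ} (hσ : IsDensity σ)
    (he : ∑ i : ABE (Rest t) d E, (if (i.1, i.2.1) ∈ typicalSet b' δ t qA qB then 0 else
      ((basisMat (Rest t) E X * σ * (basisMat (Rest t) E X)ᴴ) i i).re) ≤ η ^ 2) :
    (((n : ℝ) * (relCount b' qA + δ) * -Real.logb 2 (maxOverlap Z X) +
        n * (1 - relCount b' qA - δ) * -Real.logb 2 (maxOverlapExcept Z X a' b') : ℝ) : EReal) ≤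
      smoothMinEntropyAZ s Z σ +
        (((n : ℝ) * extEntropy d (relHammingDist qA qB + δ) / Real.logb d 2 : ℝ) : EReal) := by
  have hd0 : (0 : ℝ) < d := by exact_mod_cast (by omega : 0 < d)
  have : Nonempty (Rest t) := Fintype.card_pos_iff.1 (by rw [card_rest]; omega)
  set b₀ : ℝ := (n : ℝ) * (relCount b' qA + δ) * -Real.logb 2 (maxOverlap Z X) +
    n * (1 - relCount b' qA - δ) * -Real.logb 2 (maxOverlapExcept Z X a' b') with hb₀
  set h : ℝ := (n : ℝ) * extEntropy d (relHammingDist qA qB + δ) / Real.logb d 2 with hh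
  have hx0 : 0 ≤ relHammingDist qA qB + δ := add_nonneg (by unfold relHammingDist; positivity) hδ0
  have hO : (wordMat (Rest t) Z * (wordMat (Rest t) X)ᴴ)ᴴ *
      (wordMat (Rest t) Z * (wordMat (Rest t) X)ᴴ) = 1 := by
    rw [conjTranspose_mul, conjTranspose_conjTranspose, Matrix.mul_assoc,
      ← Matrix.mul_assoc (wordMat (Rest t) Z)ᴴ, wordMat_conjTranspose_mul, Matrix.one_mul,
      wordMat_mul_conjTranspose]
  have key : ((b₀ - h : ℝ) : EReal) ≤ smoothMinEntropyAZ s Z σ := by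
    rw [smoothMinEntropyAZ, measureA_traceOutB Z X]
    refine le_smoothMinEntropy_measureTrace hO (basisMat_conj_isDensity X hσ)
      (typicalSet b' δ t qA qB) (μ := 2 ^ (-b₀)) (M := 2 ^ h) ?_ ?_ ?_ hη0 hη1 he hs
    · intro z p hp
      refine (norm_sq_overlap_word_le hd Z X a' b' (Finset.mem_filter.1 hp).2.2).trans_eq ?_
      rw [card_rest, hb₀, sub_sub]
    · intro b
      refine (Nat.cast_le.2 (Finset.card_le_card ?_)).trans
        ((card_hammingBall_le hd b hx0).trans_eq ?_)
      · intro a ha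
        exact Finset.mem_filter.2 ⟨Finset.mem_univ _,
          (Finset.mem_filter.1 (Finset.mem_filter.1 ha).2).2.1⟩
      · rw [card_rest, hh]
        -- Converts d^(n H̄) to base 2; this is the origin of the division by log_d 2.
        have e : (d : ℝ) = 2 ^ (Real.logb d 2)⁻¹ := by
          rw [Real.inv_logb, Real.rpow_logb zero_lt_two one_lt_two.ne' hd0]
        conv_lhs => rw [e]
        rw [← Real.rpow_mul zero_le_two]
        congr 1
        ring
    · rw [← Real.rpow_add zero_lt_two]
      exact (congrArg (fun x : ℝ => (2 : ℝ) ^ x) (by ring)).le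
  calc (b₀ : EReal) = ((b₀ - h : ℝ) : EReal) + (h : EReal) := by
        rw [← EReal.coe_add, sub_add_cancel]
    _ ≤ _ := add_le_add_left key _

end QSampling

end

/-! ### Choice of the parameters -/

theorem mainTheorem2 (d n m : ℕ) (hd : 2 ≤ d) (hm : 1 ≤ m) (hmn : m ≤ n)
    (ε β : ℝ) (hε : 0 < ε) (hβ0 : 0 < β) (hβ : β < 1 / 2)
    {E : Type*} [Fintype E] [DecidableEq E]
    (ρ : Matrix (QSampling.ABE (Fin (n + m)) d E) (QSampling.ABE (Fin (n + m)) d E) ℂ)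
    (hρ : QSampling.IsDensity ρ)
    (Z X : QSampling.QBasis d) (γhat γ δ : ℝ) (astar bstar : Fin d)
    (hγhat : γhat = -Real.logb 2 (QSampling.maxOverlap Z X))
    (hstar : QSampling.overlap Z X astar bstar = QSampling.maxOverlap Z X)
    (hγ : γ = -Real.logb 2 (QSampling.maxOverlapExcept Z X astar bstar))
    (hδ : δ = Real.sqrt (((m : ℝ) + n + 2) * Real.log (4 / ε ^ 2) / ((m : ℝ) * ((m : ℝ) + n)))) :
    QSampling.experimentProb X (QSampling.uniformInput ρ)
        (fun t qA qB => ¬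
          (QSampling.smoothMinEntropyAZ (4 * ε + 2 * ε ^ β) Z
              (QSampling.postState X (QSampling.uniformInput ρ) t qA qB)
            + (((n : ℝ) * QSampling.extEntropy d (QSampling.relHammingDist qA qB + δ)
                / Real.logb d 2 : ℝ) : EReal)
            ≥ (((n : ℝ) * (QSampling.relCount bstar qA + δ) * γhat
                + (n : ℝ) * (1 - QSampling.relCount bstar qA - δ) * γ : ℝ) : EReal)))
      ≤ 2 * ε ^ (1 - 2 * β) ∧
    (γhat = γ →
      QSampling.experimentProb X (QSampling.uniformInput ρ)
          (fun t qA qB => ¬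
            (QSampling.smoothMinEntropyAZ (4 * ε + 2 * ε ^ β) Z
                (QSampling.postState X (QSampling.uniformInput ρ) t qA qB)
              + (((n : ℝ) * QSampling.extEntropy d (QSampling.relHammingDist qA qB + δ)
                  / Real.logb d 2 : ℝ) : EReal)
              ≥ (((n : ℝ) * γ : ℝ) : EReal)))
        ≤ 2 * ε ^ (1 - 2 * β)) := by
  have main : QSampling.experimentProb X (QSampling.uniformInput ρ)
        (fun t qA qB => ¬
          (QSampling.smoothMinEntropyAZ (4 * ε + 2 * ε ^ β) Z
              (QSampling.postState X (QSampling.uniformInput ρ) t qA qB)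
            + (((n : ℝ) * QSampling.extEntropy d (QSampling.relHammingDist qA qB + δ)
                / Real.logb d 2 : ℝ) : EReal)
            ≥ (((n : ℝ) * (QSampling.relCount bstar qA + δ) * γhat
                + (n : ℝ) * (1 - QSampling.relCount bstar qA - δ) * γ : ℝ) : EReal)))
      ≤ 2 * ε ^ (1 - 2 * β) := by
    -- For ε ≥ 1 the claimed bound is at least 2, so the case where the square root defining δ has a
    -- negative radicand needs no argument.
    rcases le_or_gt 1 ε with h1 | h1
    · refine (QSampling.experimentProb_le_one X hρ _).trans ?_
      have := Real.one_le_rpow h1 (by linarith : 0 ≤ 1 - 2 * β)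
      linarith
    have hm0 : (0 : ℝ) < m := by exact_mod_cast hm
    have hε2 : 0 < ε ^ 2 := by positivity
    have hL0 : 0 ≤ Real.log (4 / ε ^ 2) := Real.log_nonneg (by rw [le_div_iff₀ hε2]; nlinarith)
    have hδ0 : 0 ≤ δ := hδ ▸ Real.sqrt_nonneg _
    have hδ2 : ((m : ℝ) + n + 2) * Real.log (4 / ε ^ 2) / ((m : ℝ) * ((m : ℝ) + n)) ≤ δ ^ 2 := by
      rw [hδ, Real.sq_sqrt (by positivity)]
    have hLe : Real.exp (-Real.log (4 / ε ^ 2)) = ε ^ 2 / 4 := by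
      rw [Real.exp_neg, Real.exp_log (by positivity), inv_div]
    -- The Markov threshold η² = ε^(1+2β) / 4 turns the sampling error 2 · ε²/4 into exactly 2
    -- ε^(1-2β). The smoothing 2η + 2η² is then at most ε^β + ε/2, within the allowed 4ε + 2ε^β.
    set η : ℝ := ε ^ (1 / 2 + β) / 2 with hη
    have hη0 : 0 < η := by positivity
    have hsq : ε ^ (1 / 2 + β) * ε ^ (1 / 2 + β) = ε ^ (1 + 2 * β) := by
      rw [← Real.rpow_add hε]; ring_nf
    have hle1 : ε ^ (1 / 2 + β) ≤ ε ^ β :=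
      Real.rpow_le_rpow_of_exponent_ge hε h1.le (by linarith)
    have hle2 : ε ^ (1 + 2 * β) ≤ ε := by
      simpa using Real.rpow_le_rpow_of_exponent_ge hε h1.le (by linarith : (1 : ℝ) ≤ 1 + 2 * β)
    have hle3 : ε ^ (1 / 2 + β) ≤ 1 := Real.rpow_le_one hε.le h1.le (by linarith)
    have hβε : 0 < ε ^ β := by positivity
    have hη2 : η ^ 2 = ε ^ (1 + 2 * β) / 4 := by rw [hη, ← hsq]; ring
    have hfin : 2 * Real.exp (-Real.log (4 / ε ^ 2)) / η ^ 2 = 2 * ε ^ (1 - 2 * β) := by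
      rw [hLe, hη2, div_eq_iff (by positivity)]
      have : ε ^ (1 - 2 * β) * ε ^ (1 + 2 * β) = ε ^ 2 := by
        rw [← Real.rpow_add hε, ← Real.rpow_two]; ring_nf
      linear_combination (-1 / 2 : ℝ) * this
    rw [← hfin]
    refine QSampling.experimentProb_le_of_sampling X hρ _
      (fun t qA qB => QSampling.typicalSet bstar δ t qA qB) (by positivity)
      (QSampling.card_not_mem_typicalSet_le hm hmn bstar hδ0 hδ2) fun t qA qB hσ he => ?_
    rw [not_not, hγhat, hγ]
    exact QSampling.le_smoothMinEntropyAZ hd (hm.trans hmn) Z X astar bstar hδ0 hη0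
      (by linarith) (by rw [hη2]; linarith) t qA qB hσ he
  refine ⟨main, fun hγγ => ?_⟩
  -- The coefficients of γ̂ and γ add up to n, so the observed count and δ drop out.
  convert main using 10
  rw [hγγ]
  ring
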